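/- Let $d\ge 1$, $I\ge 0$, and let $\eta$ be a random (nuisance) variable with an arbitrary probability distribution, with expectation $\mathbb E_\eta$. Landmarks are pairs $(u,x)\in\{0,1,\dots,I\}\times\mathbb R^d$ with an auxiliary variable $u$ ($u=0$: undetected; $u=i$: belongs to the $i$-th Bernoulli component). For a finite set $\tilde X$ of landmarks put $\tilde X^{U}=\{(u,x)\in\tilde X:u=0\}$ and $\tilde X^{i}=\{(u,x)\in\tilde X:u=i\}$. Functions of finite sets are integrated by the set integral $\int g(\tilde X)\,\delta\tilde X=\sum_{n\ge0}\frac1{n!}\int g(\{y_1,\dots,y_n\})\,dy_1\cdots dy_n$, where $\int dy$ stands for $\sum_u\int dx$, and $D(f\Vert g)=\int f\log\frac fg\,\delta\tilde X\in[0,\infty]$ is the Kullback-Leibler divergence (KLD). A PMB with $I$ components is given by an integrable intensity $\lambda\ge0$ on $\mathbb R^d$, numbers $r^i\in[0,1]$ and probability densities $f^i$ on $\mathbb R^d$ ($1\le i\le I$). Its factors are $$\tilde q^{U}(\tilde X)=e^{-\int\lambda(x)\,dx}\prod_{(u,x)\in\tilde X}\delta_{0,u}\lambda(x),\qquad \tilde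 q^{i}(\tilde X)=\begin{cases}1-r^i,&\tilde X=\emptyset,\\ r^if^i(x)\,\delta_{u,i},&\tilde X=\{(u,x)\},\\ 0,&\text{otherwise,}\end{cases}$$ and its density is $\tilde q(\tilde X)=\tilde q^{U}(\tilde X^{U})\prod_{i=1}^I\tilde q^{i}(\tilde X^{i})$. For each $\eta$ let $\lambda(\cdot|\eta)$, $r^i(\eta)$, $f^i(\cdot|\eta)$ be the parameters of a PMB, depending measurably on $\eta$, with factors $\tilde f^{U}(\cdot|\eta)$ and $\tilde f^{i}(\cdot|\eta)$, and let $$\tilde f(\tilde X)=\mathbb E_\eta\Big[\tilde f^{U}(\tilde X^{U}|\eta)\prod_{i=1}^I\tilde f^{i}(\tilde X^{i}|\eta)\Big].$$ (1) The averaged factors $\mathbb E_\eta[\tilde f^{U}(\cdot|\eta)]$ and $\mathbb E_\eta[\tilde f^{i}(\cdot|\eta)]$ are set densities of landmarks labelled $0$ and $i$ respectively. Among all densities $\tilde q(\tilde X)=\tilde q^{U}(\tilde X^{U})\prod_i\tilde q^{i}(\tilde X^{i})$, where $\tilde q^{U}$ and $\tilde q^{i}$ are arbitrary set densities of landmarks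 labelled $0$ and $i$, the KLD $D(\tilde f\Vert\tilde q)$ is minimised by $$\tilde q^{U}(\tilde X)=\mathbb E_\eta[\tilde f^{U}(\tilde X|\eta)],\qquad \tilde q^{i}(\tilde X)=\mathbb E_\eta[\tilde f^{i}(\tilde X|\eta)],$$ and, if the minimum is finite, every minimiser has these factors almost everywhere. (2) Among all PMB densities $\tilde q$ with $I$ components, $D(\tilde f\Vert\tilde q)$ is minimised by every PMB with the merged parameters $$\lambda^q(x)=\mathbb E_\eta[\lambda(x|\eta)],\qquad r^i=\mathbb E_\eta[r^i(\eta)],\qquad f^i(x)=\frac{\mathbb E_\eta[r^i(\eta)f^i(x|\eta)]}{\mathbb E_\eta[r^i(\eta)]}$$ (equality of functions almost everywhere; $f^i$ is arbitrary if $r^i=0$). Such a PMB exists if $\int\mathbb E_\eta[\lambda(x|\eta)]\,dx<\infty$; and every minimiser with finite KLD has these parameters. (3) For the PMB in (2), the Bernoulli factors are $\tilde q^{i}=\mathbb E_\eta[\tilde f^{i}(\cdot|\eta)]$ almost everywhere. Its Poisson factor minimises $D(\mathbb E_\eta[\tilde f^{U}(\cdot|\eta)]\Vert\tilde q^{U})$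 among all Poisson factors, and is equal to $\mathbb E_\eta[\tilde f^{U}(\cdot|\eta)]$ almost everywhere if $\lambda(\cdot|\eta)=\lambda^q$ almost everywhere for almost every $\eta$. -/

import Mathlib

open MeasureTheory InformationTheory
open scoped ENNReal Nat

noncomputable section

namespace RFS

/-- Finite subsets of `α`. (A separate type, because Mathlib's σ-algebra on `Finset α`, generated by
the events `a ∈ S` for single points `a`, is too small when `α` is uncountable.) -/
@[ext]
structure FinSet (α : Type*) where
  points : Finset α

/-- The finite set `{x₁, …, xₙ}` listed by a tuple. -/
def toSet {α : Type*} {n : ℕ} (x : Fin n → α) : FinSet α :=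
  ⟨by classical exact Finset.univ.image x⟩

/-- A family of finite sets is measurable iff, for every `n`, the tuples `(x₁, …, xₙ)` whose
underlying set belongs to the family form a measurable subset of the `n`-fold product. -/
instance measurableSpace (α : Type*) [MeasurableSpace α] : MeasurableSpace (FinSet α) :=
  ⨅ n : ℕ, MeasurableSpace.map (toSet (n := n)) (inferInstance : MeasurableSpace (Fin n → α))

/-- The measure of the set integral
`∫ g(S) δS = ∑ₙ (1 / n!) ∫ g({x₁, …, xₙ}) dx₁ ⋯ dxₙ` over finite sets. -/
def setMeasure (α : Type*) [MeasureSpace α] : Measure (FinSet α) :=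
  Measure.sum fun n : ℕ =>
    ((n ! : ℕ) : ℝ≥0∞)⁻¹ • (Measure.pi fun _ : Fin n => (volume : Measure α)).map toSet

/-- The Kullback-Leibler divergence `D(f ‖ g) = ∫ f(S) log (f(S) / g(S)) δS` of two set
densities. -/
def setKLD {α : Type*} [MeasureSpace α] (f g : FinSet α → ℝ≥0∞) : ℝ≥0∞ :=
  klDiv ((setMeasure α).withDensity f) ((setMeasure α).withDensity g)

/-- A landmark `(u, x)` with its auxiliary variable `u ∈ {0, 1, …, I}`: `u = 0` for undetected
landmarks, `u = i` for the `i`-th Bernoulli component. -/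
abbrev Aug (I : ℕ) (X : Type*) := Fin (I + 1) × X

/-- On `{0, …, I} × X` one integrates by summing over `u` and integrating over `x`. -/
instance augMeasureSpace (I : ℕ) (X : Type*) [MeasureSpace X] : MeasureSpace (Aug I X) where
  volume := (Measure.count : Measure (Fin (I + 1))).prod (volume : Measure X)

/-- The landmarks of `S` whose auxiliary variable is `u`. -/
def slice {I : ℕ} {X : Type*} (u : Fin (I + 1)) (S : FinSet (Aug I X)) : FinSet (Aug I X) :=
  ⟨S.points.filter fun y => y.1 = u⟩

/-- The product-form density `gU(S^U) ∏ᵢ gᵢ(Sⁱ)`. -/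
def productDensity {I : ℕ} {X : Type*} (gU : FinSet (Aug I X) → ℝ≥0∞)
    (g : Fin I → FinSet (Aug I X) → ℝ≥0∞) (S : FinSet (Aug I X)) : ℝ≥0∞ :=
  gU (slice 0 S) * ∏ i : Fin I, g i (slice i.succ S)

/-- `g` is the density of a random finite set of landmarks all of which carry the auxiliary
variable `u`. -/
structure IsLabelledDensity {I : ℕ} {X : Type*} [MeasureSpace X] (u : Fin (I + 1))
    (g : FinSet (Aug I X) → ℝ≥0∞) : Prop where
  measurable : Measurable g
  integral_eq_one : ∫⁻ S, g S ∂(setMeasure (Aug I X)) = 1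
  eq_zero : ∀ S, (∃ y ∈ S.points, y.1 ≠ u) → g S = 0

/-- The parameters of a Poisson multi-Bernoulli density with `I` Bernoulli components: an
integrable Poisson intensity, existence probabilities, and spatial probability densities. -/
structure PMB (I : ℕ) (X : Type*) [MeasureSpace X] where
  intensity : X → ℝ≥0∞
  existProb : Fin I → ℝ≥0∞
  spatial : Fin I → X → ℝ≥0∞
  measurable_intensity : Measurable intensity
  intensity_finite : ∫⁻ x, intensity x ≠ ∞
  existProb_le_one : ∀ i, existProb i ≤ 1
  measurable_spatial : ∀ i, Measurable (spatial i)
  spatial_integral : ∀ i, ∫⁻ x, spatial i x = 1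

namespace PMB

variable {I : ℕ} {X : Type*} [MeasureSpace X]

/-- `exp(-∫ λ(x) dx) ∏_{(u,x) ∈ S} δ_{0,u} λ(x)`. -/
def poissonFactor (q : PMB I X) (S : FinSet (Aug I X)) : ℝ≥0∞ :=
  ENNReal.ofReal (Real.exp (-(∫⁻ x, q.intensity x).toReal)) *
    ∏ y ∈ S.points, if y.1 = 0 then q.intensity y.2 else 0

/-- `1 - rⁱ` at the empty set, `rⁱ fⁱ(x) δ_{u,i}` at `{(u,x)}`, and `0` at larger sets. The sum
in the second case has the single term `y = (u,x)`. -/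
def bernoulliFactor (q : PMB I X) (i : Fin I) (S : FinSet (Aug I X)) : ℝ≥0∞ :=
  if S.points.card = 0 then 1 - q.existProb i
  else if S.points.card = 1 then
    ∑ y ∈ S.points, if y.1 = i.succ then q.existProb i * q.spatial i y.2 else 0
  else 0

/-- The auxiliary-variable PMB density `q^U(S^U) ∏ᵢ qⁱ(Sⁱ)`. -/
def density (q : PMB I X) : FinSet (Aug I X) → ℝ≥0∞ :=
  productDensity q.poissonFactor q.bernoulliFactor

variable {H : Type*} [MeasurableSpace H]

/-- The parameters of a PMB density conditioned on a nuisance variable depend measurably on it. -/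
structure IsMeasurableFamily (F : H → PMB I X) : Prop where
  intensity : Measurable fun p : H × X => (F p.1).intensity p.2
  existProb : ∀ i, Measurable fun η : H => (F η).existProb i
  spatial : ∀ i, Measurable fun p : H × X => (F p.1).spatial i p.2

/-- `E_η [f^U(S | η)]`. -/
def meanPoissonFactor (P : Measure H) (F : H → PMB I X) (S : FinSet (Aug I X)) : ℝ≥0∞ :=
  ∫⁻ η, (F η).poissonFactor S ∂P

/-- `E_η [fⁱ(S | η)]`. -/
def meanBernoulliFactor (P : Measure H) (F : H → PMB I X) (i : Fin I)
    (S : FinSet (Aug I X)) : ℝ≥0∞ :=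
  ∫⁻ η, (F η).bernoulliFactor i S ∂P

/-- `E_η [f^U(S^U | η) ∏ᵢ fⁱ(Sⁱ | η)]`. -/
def meanDensity (P : Measure H) (F : H → PMB I X) (S : FinSet (Aug I X)) : ℝ≥0∞ :=
  ∫⁻ η, (F η).density S ∂P

/-- `q` has the merged parameters `λ(x) = E_η[λ(x|η)]`, `rⁱ = E_η[rⁱ(η)]` and, where `rⁱ ≠ 0`,
`fⁱ(x) = E_η[rⁱ(η) fⁱ(x|η)] / E_η[rⁱ(η)]`. -/
structure IsMerged (P : Measure H) (F : H → PMB I X) (q : PMB I X) : Prop where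
  intensity : q.intensity =ᵐ[volume] fun x => ∫⁻ η, (F η).intensity x ∂P
  existProb : ∀ i, q.existProb i = ∫⁻ η, (F η).existProb i ∂P
  spatial : ∀ i, q.existProb i ≠ 0 → q.spatial i =ᵐ[volume] fun x =>
    (∫⁻ η, (F η).existProb i * (F η).spatial i x ∂P) / ∫⁻ η, (F η).existProb i ∂P

end PMB

end RFS

end

open RFS

namespace RFS

section KL

variable {Ω : Type*} [MeasurableSpace Ω] {ν : Measure Ω} {f g r : Ω → ℝ≥0∞}

lemma measurable_ofReal_neg {w : Ω → ℝ} (hw : Measurable w) :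
    Measurable fun x => ENNReal.ofReal (-w x) :=
  hw.neg.ennreal_ofReal

/-- The log-likelihood ratio of two densities. -/
noncomputable def logRatio (f g : Ω → ℝ≥0∞) (x : Ω) : ℝ :=
  Real.log (f x).toReal - Real.log (g x).toReal

lemma measurable_logRatio (hf : Measurable f) (hg : Measurable g) : Measurable (logRatio f g) := by
  unfold logRatio
  fun_prop

lemma ae_withDensity_ne_zero (hf : Measurable f) : ∀ᵐ x ∂ν.withDensity f, f x ≠ 0 := by
  rw [ae_withDensity_iff hf]
  exact Filter.Eventually.of_forall fun _ h => h

lemma ae_withDensity_lt_top (hg : Measurable g) (hgi : ∫⁻ x, g x ∂ν ≠ ∞) :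
    ∀ᵐ x ∂ν.withDensity f, g x < ∞ :=
  (withDensity_absolutelyContinuous ν f).ae_le (ae_lt_top hg hgi)

lemma withDensity_absolutelyContinuous_iff (hg : Measurable g) :
    ν.withDensity f ≪ ν.withDensity g ↔ ∀ᵐ x ∂ν.withDensity f, g x ≠ 0 := by
  constructor
  · intro h
    exact h.ae_le (ae_withDensity_ne_zero hg)
  · intro h
    refine Measure.AbsolutelyContinuous.mk fun s hs h0 => ?_
    rw [withDensity_apply _ hs, lintegral_eq_zero_iff hg] at h0
    have h1 : ∀ᵐ x ∂ν.withDensity f, x ∈ s → g x = 0 := by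
      refine (withDensity_absolutelyContinuous ν f).ae_le ?_
      rwa [Filter.EventuallyEq, ae_restrict_iff' hs] at h0
    have : ∀ᵐ x ∂ν.withDensity f, x ∉ s := by
      filter_upwards [h, h1] with x hx hx1 hxs using hx (hx1 hxs)
    simpa [ae_iff] using this

lemma llr_withDensity_ae_eq (hf : Measurable f) (hg : Measurable g)
    (hfi : ∫⁻ x, f x ∂ν ≠ ∞) (hgi : ∫⁻ x, g x ∂ν ≠ ∞)
    (h : ∀ᵐ x ∂ν.withDensity f, g x ≠ 0) :
    llr (ν.withDensity f) (ν.withDensity g) =ᵐ[ν.withDensity f] logRatio f g := by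
  have : IsFiniteMeasure (ν.withDensity g) := isFiniteMeasure_withDensity hgi
  have hq : ν.withDensity f = (ν.withDensity g).withDensity (f / g) := by
    rw [← withDensity_mul _ hg (hf.div hg)]
    refine withDensity_congr_ae ?_
    have h' := (ae_withDensity_iff hf).1 h
    filter_upwards [h', ae_lt_top hg hgi] with x hx hx1
    by_cases h0 : f x = 0
    · simp [h0]
    · simp only [Pi.mul_apply, Pi.div_apply]
      exact (ENNReal.mul_div_cancel (hx h0) hx1.ne).symm
  have h1 : (ν.withDensity f).rnDeriv (ν.withDensity g) =ᵐ[ν.withDensity f]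
      fun x => f x / g x := by
    refine ((withDensity_absolutelyContinuous_iff hg).2 h).ae_le ?_
    nth_rewrite 1 [hq]
    exact Measure.rnDeriv_withDensity _ (hf.div hg)
  filter_upwards [h1, h, ae_withDensity_ne_zero hf, ae_withDensity_lt_top hg hgi,
    ae_withDensity_lt_top hf hfi] with x hx h2 h3 h4 h5
  rw [llr, hx, logRatio, ENNReal.toReal_div, Real.log_div]
  · exact (ENNReal.toReal_pos h3 h5.ne).ne'
  · exact (ENNReal.toReal_pos h2 h4.ne).ne'

lemma klDiv_withDensity_ne_top_iff (hf : Measurable f) (hg : Measurable g)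
    (hfi : ∫⁻ x, f x ∂ν ≠ ∞) (hgi : ∫⁻ x, g x ∂ν ≠ ∞) :
    klDiv (ν.withDensity f) (ν.withDensity g) ≠ ∞ ↔
      (∀ᵐ x ∂ν.withDensity f, g x ≠ 0) ∧ Integrable (logRatio f g) (ν.withDensity f) := by
  rw [klDiv_ne_top_iff, withDensity_absolutelyContinuous_iff hg]
  exact and_congr_right fun h => integrable_congr (llr_withDensity_ae_eq hf hg hfi hgi h)

lemma toReal_klDiv_withDensity (hf : Measurable f) (hg : Measurable g)
    (hfi : ∫⁻ x, f x ∂ν ≠ ∞) (hgi : ∫⁻ x, g x ∂ν ≠ ∞)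
    (h : ∀ᵐ x ∂ν.withDensity f, g x ≠ 0)
    (hi : Integrable (logRatio f g) (ν.withDensity f)) :
    (klDiv (ν.withDensity f) (ν.withDensity g)).toReal =
      ∫ x, logRatio f g x ∂ν.withDensity f + (∫⁻ x, g x ∂ν).toReal - (∫⁻ x, f x ∂ν).toReal := by
  have : IsFiniteMeasure (ν.withDensity g) := isFiniteMeasure_withDensity hgi
  have : IsFiniteMeasure (ν.withDensity f) := isFiniteMeasure_withDensity hfi
  have hl := llr_withDensity_ae_eq hf hg hfi hgi h
  rw [toReal_klDiv ((withDensity_absolutelyContinuous_iff hg).2 h)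
    ((integrable_congr hl).2 hi), integral_congr_ae hl]
  simp [Measure.real]

/-- The negative part of the log-likelihood ratio is integrable. -/
lemma lintegral_ofReal_neg_logRatio_lt_top (hf : Measurable f) (hg : Measurable g)
    (hfi : ∫⁻ x, f x ∂ν ≠ ∞) (hgi : ∫⁻ x, g x ∂ν ≠ ∞)
    (h : ∀ᵐ x ∂ν.withDensity f, g x ≠ 0) :
    ∫⁻ x, ENNReal.ofReal (-logRatio f g x) ∂ν.withDensity f < ∞ := by
  rw [lintegral_withDensity_eq_lintegral_mul _ hf
    (measurable_ofReal_neg (measurable_logRatio hf hg))]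
  refine lt_of_le_of_lt (lintegral_mono_ae ?_) hgi.lt_top
  have h' := (ae_withDensity_iff hf).1 h
  filter_upwards [h', ae_lt_top hg hgi, ae_lt_top hf hfi] with x h1 h2 h3
  by_cases h0 : f x = 0
  · simp [h0]
  have hfp := ENNReal.toReal_pos h0 h3.ne
  have hgp := ENNReal.toReal_pos (h1 h0) h2.ne
  have key : (f x).toReal * -logRatio f g x ≤ (g x).toReal := by
    have := Real.log_le_sub_one_of_pos (div_pos hgp hfp)
    rw [Real.log_div hgp.ne' hfp.ne'] at this
    have h4 : -logRatio f g x ≤ (g x).toReal / (f x).toReal - 1 := by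
      unfold logRatio; linarith
    calc _ ≤ (f x).toReal * ((g x).toReal / (f x).toReal - 1) := by gcongr
      _ = (g x).toReal - (f x).toReal := by field_simp
      _ ≤ _ := by linarith
  calc f x * ENNReal.ofReal (-logRatio f g x)
      = ENNReal.ofReal ((f x).toReal * -logRatio f g x) := by
        rw [ENNReal.ofReal_mul hfp.le, ENNReal.ofReal_toReal h3.ne]
    _ ≤ ENNReal.ofReal (g x).toReal := ENNReal.ofReal_le_ofReal key
    _ = g x := ENNReal.ofReal_toReal h2.ne

/-- If `D(f ‖ g)` is finite, then the positive part of `log (r / g)` is `f`-integrable for every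
density `r` of finite mass. -/
lemma lintegral_ofReal_logRatio_lt_top (hf : Measurable f) (hg : Measurable g) (hr : Measurable r)
    (hfi : ∫⁻ x, f x ∂ν ≠ ∞) (hgi : ∫⁻ x, g x ∂ν ≠ ∞) (hri : ∫⁻ x, r x ∂ν ≠ ∞)
    (h : ∀ᵐ x ∂ν.withDensity f, r x ≠ 0)
    (hfin : klDiv (ν.withDensity f) (ν.withDensity g) ≠ ∞) :
    ∫⁻ x, ENNReal.ofReal (logRatio r g x) ∂ν.withDensity f < ∞ := by
  obtain ⟨-, hi⟩ := (klDiv_withDensity_ne_top_iff hf hg hfi hgi).1 hfin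
  calc ∫⁻ x, ENNReal.ofReal (logRatio r g x) ∂ν.withDensity f
      ≤ ∫⁻ x, (ENNReal.ofReal (logRatio f g x) + ENNReal.ofReal (-logRatio f r x))
          ∂ν.withDensity f := by
        refine lintegral_mono fun x => ?_
        have : logRatio r g x = logRatio f g x + -logRatio f r x := by unfold logRatio; ring
        rw [this]
        exact ENNReal.ofReal_add_le
    _ = ∫⁻ x, ENNReal.ofReal (logRatio f g x) ∂ν.withDensity f +
          ∫⁻ x, ENNReal.ofReal (-logRatio f r x) ∂ν.withDensity f :=
        lintegral_add_left (measurable_logRatio hf hg).ennreal_ofReal _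
    _ < ∞ := ENNReal.add_lt_top.2 ⟨hi.lintegral_lt_top,
        lintegral_ofReal_neg_logRatio_lt_top hf hr hfi hri h⟩

/-- Pythagorean identity for the Kullback-Leibler divergence. -/
lemma klDiv_withDensity_eq_add (hf : Measurable f) (hg : Measurable g) (hr : Measurable r)
    (hfi : ∫⁻ x, f x ∂ν ≠ ∞) (hgi : ∫⁻ x, g x ∂ν ≠ ∞) (hri : ∫⁻ x, r x ∂ν ≠ ∞)
    (hr0 : ∀ᵐ x ∂ν.withDensity f, r x ≠ 0) (hg0 : ∀ᵐ x ∂ν.withDensity f, g x ≠ 0)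
    (hw : Integrable (logRatio r g) (ν.withDensity f)) {c : ℝ≥0∞} (hc : c ≠ ∞)
    (hceq : c.toReal = ∫ x, logRatio r g x ∂ν.withDensity f
      + (∫⁻ x, g x ∂ν).toReal - (∫⁻ x, r x ∂ν).toReal) :
    klDiv (ν.withDensity f) (ν.withDensity g) = klDiv (ν.withDensity f) (ν.withDensity r) + c := by
  have e1 : logRatio f g = logRatio f r + logRatio r g := by
    ext x; simp [logRatio]
  have e2 : logRatio f r = logRatio f g - logRatio r g := by
    ext x; simp [logRatio]
  by_cases hi : Integrable (logRatio f r) (ν.withDensity f)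
  · have hi' : Integrable (logRatio f g) (ν.withDensity f) := by rw [e1]; exact hi.add hw
    have t1 := (klDiv_withDensity_ne_top_iff hf hg hfi hgi).2 ⟨hg0, hi'⟩
    have t2 := (klDiv_withDensity_ne_top_iff hf hr hfi hri).2 ⟨hr0, hi⟩
    rw [← ENNReal.toReal_eq_toReal_iff' t1 (ENNReal.add_ne_top.2 ⟨t2, hc⟩),
      ENNReal.toReal_add t2 hc, toReal_klDiv_withDensity hf hg hfi hgi hg0 hi',
      toReal_klDiv_withDensity hf hr hfi hri hr0 hi, hceq, e1]
    simp only [Pi.add_apply]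
    rw [integral_add hi hw]
    ring
  · have hi' : ¬ Integrable (logRatio f g) (ν.withDensity f) := fun h' =>
      hi (by rw [e2]; exact h'.sub hw)
    have t1 : klDiv (ν.withDensity f) (ν.withDensity g) = ∞ := by
      by_contra h'
      exact hi' ((klDiv_withDensity_ne_top_iff hf hg hfi hgi).1 h').2
    have t2 : klDiv (ν.withDensity f) (ν.withDensity r) = ∞ := by
      by_contra h'
      exact hi ((klDiv_withDensity_ne_top_iff hf hr hfi hri).1 h').2
    rw [t1, t2, top_add]

/-- A measurable function with integrable positive and negative parts is integrable. -/
lemma integrable_of_lintegral_ofReal {μ : Measure Ω} {w : Ω → ℝ} (hw : Measurable w)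
    (h1 : ∫⁻ x, ENNReal.ofReal (w x) ∂μ < ∞) (h2 : ∫⁻ x, ENNReal.ofReal (-w x) ∂μ < ∞) :
    Integrable w μ := by
  refine ⟨hw.aestronglyMeasurable, ?_⟩
  have : ∀ x, ‖w x‖ₑ = ENNReal.ofReal (w x) + ENNReal.ofReal (-w x) := by
    intro x
    rw [Real.enorm_eq_ofReal_abs]
    rcases le_total 0 (w x) with h | h
    · rw [abs_of_nonneg h, ENNReal.ofReal_of_nonpos (neg_nonpos.2 h), add_zero]
    · rw [abs_of_nonpos h, ENNReal.ofReal_of_nonpos h, zero_add]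
  rw [HasFiniteIntegral]
  simp_rw [this]
  rw [lintegral_add_left hw.ennreal_ofReal]
  exact ENNReal.add_lt_top.2 ⟨h1, h2⟩

end KL

section Sets

variable {α : Type*}

/-- The finite set of values of a finite family of points. -/
noncomputable def rangeSet {ι : Type*} [Fintype ι] (x : ι → α) : FinSet α :=
  ⟨by classical exact Finset.univ.image x⟩

/-- The points of a finite set that satisfy `p`. -/
def filterSet (p : α → Prop) [DecidablePred p] (S : FinSet α) : FinSet α :=
  ⟨S.points.filter p⟩

lemma rangeSet_eq_toSet {n : ℕ} (x : Fin n → α) : rangeSet x = toSet x := rfl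

@[simp]
lemma mem_rangeSet {ι : Type*} [Fintype ι] (x : ι → α) (y : α) :
    y ∈ (rangeSet x).points ↔ ∃ i, x i = y := by
  classical simp [rangeSet]

@[simp]
lemma mem_toSet {n : ℕ} (x : Fin n → α) (y : α) : y ∈ (toSet x).points ↔ ∃ i, x i = y :=
  mem_rangeSet x y

@[simp]
lemma mem_filterSet (p : α → Prop) [DecidablePred p] (S : FinSet α) (y : α) :
    y ∈ (filterSet p S).points ↔ y ∈ S.points ∧ p y := by
  simp [filterSet]

lemma rangeSet_comp_equiv {ι κ : Type*} [Fintype ι] [Fintype κ] (e : κ ≃ ι) (x : ι → α) :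
    rangeSet (fun k => x (e k)) = rangeSet x := by
  ext y
  rw [mem_rangeSet, mem_rangeSet, e.exists_congr_left]
  simp

lemma filterSet_rangeSet {ι : Type*} [Fintype ι] (p : α → Prop) [DecidablePred p] (x : ι → α)
    (J : Finset ι) (hJ : ∀ i, i ∈ J ↔ p (x i)) :
    filterSet p (rangeSet x) = rangeSet fun j : {j // j ∈ J} => x j := by
  ext y
  rw [mem_filterSet, mem_rangeSet, mem_rangeSet]
  constructor
  · rintro ⟨⟨i, rfl⟩, hi⟩
    exact ⟨⟨i, (hJ i).2 hi⟩, rfl⟩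
  · rintro ⟨⟨i, hi⟩, rfl⟩
    exact ⟨⟨i, rfl⟩, (hJ i).1 hi⟩

/-- The indices at which the values of a tuple occur for the first time. -/
def firstIndices [DecidableEq α] {n : ℕ} (x : Fin n → α) : Finset (Fin n) :=
  Finset.univ.filter fun i => ∀ j < i, x j ≠ x i

lemma points_toSet_eq_image [DecidableEq α] {n : ℕ} (x : Fin n → α) :
    (toSet x).points = (firstIndices x).image x := by
  ext y
  simp only [mem_toSet, Finset.mem_image, firstIndices, Finset.mem_filter, Finset.mem_univ,
    true_and]
  constructor
  · rintro ⟨i, hi⟩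
    obtain ⟨k, hk, hmin⟩ := WellFounded.has_min (wellFounded_lt (α := Fin n))
      {j | x j = y} ⟨i, hi⟩
    exact ⟨k, fun j hj hjk => hmin j (hjk.trans hk) hj, hk⟩
  · rintro ⟨i, -, hi⟩
    exact ⟨i, hi⟩

lemma injOn_firstIndices [DecidableEq α] {n : ℕ} (x : Fin n → α) :
    Set.InjOn x (firstIndices x) := by
  intro i hi j hj hij
  simp only [firstIndices, Finset.coe_filter, Finset.mem_univ, true_and, Set.mem_ofPred_eq] at hi hj
  rcases lt_trichotomy i j with h | h | h
  · exact absurd hij (hj i h)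
  · exact h
  · exact absurd hij.symm (hi j h)

@[to_additive]
lemma prod_points_toSet [DecidableEq α] {n : ℕ} (x : Fin n → α) {M : Type*} [CommMonoid M]
    (h : α → M) :
    ∏ y ∈ (toSet x).points, h y = ∏ i, if ∀ j < i, x j ≠ x i then h (x i) else 1 := by
  rw [points_toSet_eq_image, Finset.prod_image (injOn_firstIndices x), firstIndices,
    Finset.prod_filter]

@[to_additive]
lemma prod_points_toSet_of_injective {n : ℕ} {x : Fin n → α} (hx : Function.Injective x)
    {M : Type*} [CommMonoid M] (h : α → M) :
    ∏ y ∈ (toSet x).points, h y = ∏ i, h (x i) := by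
  classical
  have : (toSet x).points = Finset.univ.image x := by ext y; simp
  rw [this, Finset.prod_image hx.injOn]

end Sets

section Measurability

variable {α β H : Type*} [MeasurableSpace α] [MeasurableSpace β] [MeasurableSpace H]

lemma measurable_toSet (n : ℕ) : Measurable (toSet : (Fin n → α) → FinSet α) := by
  intro s hs
  rw [measurableSpace, MeasurableSpace.measurableSet_iInf] at hs
  exact hs n

lemma measurableSet_finSet_iff {s : Set (FinSet α)} :
    MeasurableSet s ↔ ∀ n, MeasurableSet {x : Fin n → α | toSet x ∈ s} := by
  rw [measurableSpace, MeasurableSpace.measurableSet_iInf]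
  rfl

lemma measurable_finSet_iff {g : FinSet α → β} :
    Measurable g ↔ ∀ n, Measurable fun x : Fin n → α => g (toSet x) := by
  constructor
  · exact fun h n => h.comp (measurable_toSet n)
  · intro h s hs
    exact measurableSet_finSet_iff.2 fun n => h n hs

/-- A family of functions of finite sets that, listed as functions of tuples, depends jointly
measurably on the parameter and the tuple. -/
def JointlyMeasurable (g : H → FinSet α → ℝ≥0∞) : Prop :=
  ∀ n, Measurable fun p : H × (Fin n → α) => g p.1 (toSet p.2)

lemma JointlyMeasurable.measurable {g : H → FinSet α → ℝ≥0∞} (hg : JointlyMeasurable g) (η : H) :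
    Measurable (g η) :=
  measurable_finSet_iff.2 fun n => (hg n).comp measurable_prodMk_left

lemma JointlyMeasurable.of_measurable {g : FinSet α → ℝ≥0∞} (hg : Measurable g) :
    JointlyMeasurable fun _ : H => g :=
  fun n => (measurable_finSet_iff.1 hg n).comp measurable_snd

lemma JointlyMeasurable.mul {g h : H → FinSet α → ℝ≥0∞} (hg : JointlyMeasurable g)
    (hh : JointlyMeasurable h) : JointlyMeasurable fun η S => g η S * h η S :=
  fun n => (hg n).mul (hh n)

lemma JointlyMeasurable.prod {ι : Type*} {s : Finset ι} {g : ι → H → FinSet α → ℝ≥0∞}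
    (hg : ∀ i, JointlyMeasurable (g i)) : JointlyMeasurable fun η S => ∏ i ∈ s, g i η S :=
  fun n => Finset.measurable_fun_prod _ fun i _ => hg i n

lemma measurable_comp_rangeSet {g : H → FinSet α → ℝ≥0∞} (hg : JointlyMeasurable g)
    {ι : Type*} [Fintype ι] : Measurable fun p : H × (ι → α) => g p.1 (rangeSet p.2) := by
  have e := (Fintype.equivFin ι).symm
  have : (fun p : H × (ι → α) => g p.1 (rangeSet p.2)) =
      (fun p : H × (Fin (Fintype.card ι) → α) => g p.1 (toSet p.2)) ∘
        fun p : H × (ι → α) => (p.1, fun k => p.2 (e k)) := by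
    ext p
    simp only [Function.comp]
    rw [← rangeSet_eq_toSet, rangeSet_comp_equiv]
  rw [this]
  exact (hg _).comp (by fun_prop)

lemma measurable_filter_univ {p : α → Prop} [DecidablePred p] (hp : MeasurableSet {y | p y})
    {ι : Type*} [Fintype ι] [DecidableEq ι] (J : Finset ι) :
    MeasurableSet {x : ι → α | Finset.univ.filter (fun i => p (x i)) = J} := by
  have : {x : ι → α | Finset.univ.filter (fun i => p (x i)) = J} =
      ⋂ i, {x : ι → α | p (x i) ↔ i ∈ J} := by
    ext x
    simp [Finset.ext_iff]
  rw [this]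
  refine MeasurableSet.iInter fun i => ?_
  by_cases hi : i ∈ J
  · simpa [hi] using measurable_pi_apply (X := fun _ : ι => α) i hp
  · simp only [hi, iff_false]
    exact (measurable_pi_apply (X := fun _ : ι => α) i hp).compl

lemma JointlyMeasurable.comp_filterSet {g : H → FinSet α → ℝ≥0∞} (hg : JointlyMeasurable g)
    {p : α → Prop} [DecidablePred p] (hp : MeasurableSet {y | p y}) :
    JointlyMeasurable fun η S => g η (filterSet p S) := by
  intro n
  have h1 : (fun q : H × (Fin n → α) => g q.1 (filterSet p (toSet q.2))) =
      fun q => ∑ J : Finset (Fin n),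
        if Finset.univ.filter (fun i => p (q.2 i)) = J then
          g q.1 (rangeSet fun j : {j // j ∈ J} => q.2 j) else 0 := by
    ext q
    rw [Finset.sum_ite_eq, if_pos (Finset.mem_univ _), ← rangeSet_eq_toSet,
      filterSet_rangeSet p q.2 (Finset.univ.filter fun i => p (q.2 i)) (by simp)]
  rw [h1]
  refine Finset.measurable_fun_sum _ fun J _ => Measurable.ite
    (measurable_snd (measurable_filter_univ hp J)) ?_ measurable_const
  exact (measurable_comp_rangeSet hg).comp (measurable_fst.prodMk (by fun_prop) :
    Measurable fun q : H × (Fin n → α) => (q.1, fun j : {j // j ∈ J} => q.2 j))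

lemma measurable_filterSet {p : α → Prop} [DecidablePred p] (hp : MeasurableSet {y | p y}) :
    Measurable (filterSet p) := by
  intro s hs
  have h1 : JointlyMeasurable fun (_ : Unit) => s.indicator (1 : FinSet α → ℝ≥0∞) :=
    .of_measurable (measurable_one.indicator hs)
  have h2 := (h1.comp_filterSet hp).measurable () (measurableSet_singleton 1)
  convert h2 using 1
  ext S
  by_cases h : filterSet p S ∈ s <;> simp [h]

lemma measurableSet_forall_mem {p : α → Prop} (hp : MeasurableSet {y | p y}) :
    MeasurableSet {S : FinSet α | ∀ y ∈ S.points, p y} := by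
  rw [measurableSet_finSet_iff]
  intro n
  have : {x : Fin n → α | toSet x ∈ {S : FinSet α | ∀ y ∈ S.points, p y}} =
      ⋂ i, (fun x : Fin n → α => x i) ⁻¹' {y | p y} := by
    ext x; simp
  rw [this]
  exact MeasurableSet.iInter fun i => measurable_pi_apply i hp

lemma jointlyMeasurable_prod_points [MeasurableEq α] {h : H → α → ℝ≥0∞}
    (hh : Measurable fun p : H × α => h p.1 p.2) :
    JointlyMeasurable fun η S => ∏ y ∈ S.points, h η y := by
  classical
  intro n
  simp only [prod_points_toSet]
  refine Finset.measurable_fun_prod _ fun i _ => Measurable.ite ?_ ?_ measurable_const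
  · simp only [Set.ofPred_forall]
    refine MeasurableSet.iInter fun j => MeasurableSet.iInter fun _ => ?_
    exact (measurableSet_eq_fun (by fun_prop) (by fun_prop)).compl
  · exact hh.comp (measurable_fst.prodMk (by fun_prop))

lemma jointlyMeasurable_sum_points [MeasurableEq α] {h : H → α → ℝ≥0∞}
    (hh : Measurable fun p : H × α => h p.1 p.2) :
    JointlyMeasurable fun η S => ∑ y ∈ S.points, h η y := by
  classical
  intro n
  simp only [sum_points_toSet]
  refine Finset.measurable_fun_sum _ fun i _ => Measurable.ite ?_ ?_ measurable_const
  · simp only [Set.ofPred_forall]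
    refine MeasurableSet.iInter fun j => MeasurableSet.iInter fun _ => ?_
    exact (measurableSet_eq_fun (by fun_prop) (by fun_prop)).compl
  · exact hh.comp (measurable_fst.prodMk (by fun_prop))

lemma measurable_prod_points [MeasurableEq α] {a : α → ℝ≥0∞} (ha : Measurable a) :
    Measurable fun S : FinSet α => ∏ y ∈ S.points, a y :=
  (jointlyMeasurable_prod_points (H := Unit) (h := fun _ => a)
    (ha.comp measurable_snd)).measurable ()

lemma measurable_sum_points [MeasurableEq α] {h : α → ℝ≥0∞} (hh : Measurable h) :
    Measurable fun S : FinSet α => ∑ y ∈ S.points, h y :=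
  (jointlyMeasurable_sum_points (H := Unit) (h := fun _ => h)
    (hh.comp measurable_snd)).measurable ()

lemma measurable_card_points [MeasurableEq α] : Measurable fun S : FinSet α => S.points.card := by
  classical
  rw [measurable_finSet_iff]
  intro n
  simp only [Finset.card_eq_sum_ones, sum_points_toSet]
  refine Finset.measurable_fun_sum _ fun i _ => Measurable.ite ?_ measurable_const measurable_const
  simp only [Set.ofPred_forall]
  refine MeasurableSet.iInter fun j => MeasurableSet.iInter fun _ => ?_
  exact (measurableSet_eq_fun (by fun_prop) (by fun_prop)).compl

end Measurability

section Integral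

variable {α : Type*} [MeasureSpace α]

lemma lintegral_setMeasure {g : FinSet α → ℝ≥0∞} (hg : Measurable g) :
    ∫⁻ S, g S ∂setMeasure α =
      ∑' n : ℕ, ((n ! : ℕ) : ℝ≥0∞)⁻¹ * ∫⁻ x : Fin n → α, g (toSet x) ∂Measure.pi fun _ => volume := by
  rw [setMeasure, lintegral_sum_measure]
  refine tsum_congr fun n => ?_
  rw [lintegral_smul_measure, lintegral_map hg (measurable_toSet n), smul_eq_mul]

lemma ae_setMeasure {p : FinSet α → Prop} (hp : MeasurableSet {S | p S})
    (h : ∀ n, ∀ᵐ x : Fin n → α ∂Measure.pi fun _ => volume, p (toSet x)) :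
    ∀ᵐ S ∂setMeasure α, p S := by
  rw [setMeasure, Measure.ae_sum_iff' hp]
  intro n
  refine Measure.ae_smul_measure ?_ _
  rw [ae_map_iff (measurable_toSet n).aemeasurable hp]
  exact h n

lemma ae_toSet_of_ae_setMeasure {p : FinSet α → Prop} (h : ∀ᵐ S ∂setMeasure α, p S) (n : ℕ) :
    ∀ᵐ x : Fin n → α ∂Measure.pi fun _ => volume, p (toSet x) := by
  have h1 : ∀ᵐ S ∂((n ! : ℕ) : ℝ≥0∞)⁻¹ •
      (Measure.pi fun _ : Fin n => (volume : Measure α)).map toSet, p S :=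
    (Measure.absolutelyContinuous_of_le (Measure.le_sum _ n)).ae_le h
  rw [Measure.ae_ennreal_smul_measure_iff (by simp)] at h1
  exact ae_of_ae_map (measurable_toSet n).aemeasurable h1

variable [SigmaFinite (volume : Measure α)]

instance : SFinite (setMeasure α) := by
  unfold setMeasure
  infer_instance

lemma ae_forall_mem {p : α → Prop} (h : ∀ᵐ y : α, p y) :
    ∀ᵐ S ∂setMeasure α, ∀ y ∈ S.points, p y := by
  obtain ⟨t, ht, hm, h0⟩ := exists_measurable_superset_of_null (ae_iff.1 h)
  have h1 : ∀ᵐ S ∂setMeasure α, ∀ y ∈ S.points, y ∈ tᶜ := by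
    refine ae_setMeasure (measurableSet_forall_mem hm.compl) fun n => ?_
    have : ∀ᵐ x : Fin n → α ∂Measure.pi fun _ => volume, ∀ i, x i ∈ tᶜ := by
      rw [ae_all_iff]
      intro i
      exact Measure.tendsto_eval_ae_ae.eventually (compl_mem_ae_iff.2 h0)
    filter_upwards [this] with x hx y hy
    obtain ⟨i, rfl⟩ := (mem_toSet x y).1 hy
    exact hx i
  filter_upwards [h1] with S hS y hy
  by_contra hn
  exact hS y hy (ht hn)

lemma ae_injective [NullSingletonClass (volume : Measure α)] [MeasurableEq α] (n : ℕ) :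
    ∀ᵐ x : Fin n → α ∂Measure.pi fun _ => volume, Function.Injective x := by
  have h : ∀ i j : Fin n, i ≠ j →
      ∀ᵐ x : Fin n → α ∂Measure.pi fun _ => volume, x i ≠ x j := by
    intro i j hij
    cases n with
    | zero => exact i.elim0
    | succ n =>
      obtain ⟨k, rfl⟩ := Fin.exists_succAbove_eq hij.symm
      have hmp := measurePreserving_piFinSuccAbove (fun _ : Fin (n + 1) => (volume : Measure α)) i
      have h2 : ∀ᵐ z : α × (Fin n → α) ∂(volume : Measure α).prod
          (Measure.pi fun _ => volume), z.1 ≠ z.2 k := by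
        have hs : MeasurableSet {z : α × (Fin n → α) | z.1 ≠ z.2 k} :=
          (measurableSet_eq_fun (by fun_prop) (by fun_prop)).compl
        have h3 : ∀ᵐ z : (Fin n → α) × α ∂(Measure.pi fun _ => volume).prod
            (volume : Measure α), z.2 ≠ z.1 k := by
          refine (Measure.ae_prod_iff_ae_ae ?_).2 (Filter.Eventually.of_forall fun x => ?_)
          · exact (measurableSet_eq_fun (by fun_prop) (by fun_prop)).compl
          · simp [ae_iff]
        exact (Measure.measurePreserving_swap (μ := (volume : Measure α))
          (ν := Measure.pi fun _ : Fin n => (volume : Measure α))).quasiMeasurePreserving.ae h3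
      have h4 := hmp.quasiMeasurePreserving.ae h2
      filter_upwards [h4] with x hx
      simpa [Fin.removeNth] using hx
  have : ∀ᵐ x : Fin n → α ∂Measure.pi fun _ => volume, ∀ i j : Fin n, i ≠ j → x i ≠ x j := by
    simp only [ae_all_iff]
    exact h
  filter_upwards [this] with x hx i j hij
  by_contra hne
  exact hx i j hne hij

lemma lintegral_rangeSet {g : FinSet α → ℝ≥0∞} {ι : Type*} [Fintype ι] :
    ∫⁻ x : ι → α, g (rangeSet x) ∂Measure.pi (fun _ => volume) =
      ∫⁻ x : Fin (Fintype.card ι) → α, g (toSet x) ∂Measure.pi (fun _ => volume) := by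
  have e := (Fintype.equivFin ι)
  have hmp := measurePreserving_piCongrLeft (fun _ : Fin (Fintype.card ι) => (volume : Measure α)) e
  rw [← hmp.lintegral_comp_emb (MeasurableEquiv.measurableEmbedding _)]
  refine lintegral_congr fun x => ?_
  congr 1
  rw [← rangeSet_eq_toSet, ← rangeSet_comp_equiv e]
  congr 1
  ext k
  simp [MeasurableEquiv.coe_piCongrLeft]

lemma lintegral_mul_rangeSet {g h : FinSet α → ℝ≥0∞} (hg : Measurable g) (hh : Measurable h)
    {n : ℕ} (J : Finset (Fin n)) :
    ∫⁻ x : Fin n → α, g (rangeSet fun j : {j // j ∈ J} => x j) *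
        h (rangeSet fun j : {j // j ∈ Jᶜ} => x j) ∂Measure.pi (fun _ => volume) =
      (∫⁻ x : Fin J.card → α, g (toSet x) ∂Measure.pi (fun _ => volume)) *
        ∫⁻ x : Fin (n - J.card) → α, h (toSet x) ∂Measure.pi (fun _ => volume) := by
  have hmp := measurePreserving_piEquivPiSubtypeProd
    (fun _ : Fin n => (volume : Measure α)) (fun i => i ∈ J)
  have hg' := measurable_comp_rangeSet (H := Unit) (ι := {j // j ∈ J}) (.of_measurable hg)
  have hh' := measurable_comp_rangeSet (H := Unit) (ι := {j // ¬ j ∈ J}) (.of_measurable hh)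
  replace hg' : Measurable fun x : {j // j ∈ J} → α => g (rangeSet x) :=
    hg'.comp (measurable_prodMk_left (x := ()))
  replace hh' : Measurable fun x : {j // ¬ j ∈ J} → α => h (rangeSet x) :=
    hh'.comp (measurable_prodMk_left (x := ()))
  have h1 := lintegral_prod_mul
    (μ := Measure.pi fun _ : {j // j ∈ J} => (volume : Measure α))
    (ν := Measure.pi fun _ : {j // ¬ j ∈ J} => (volume : Measure α))
    hg'.aemeasurable hh'.aemeasurable
  have h2 := hmp.lintegral_comp_emb (MeasurableEquiv.measurableEmbedding _)
    fun z => g (rangeSet z.1) * h (rangeSet z.2)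
  rw [lintegral_rangeSet, lintegral_rangeSet] at h1
  have c1 : Fintype.card {j // j ∈ J} = J.card := by simp
  have c2 : Fintype.card {j // ¬ j ∈ J} = n - J.card := by
    rw [Fintype.card_subtype_compl]; simp
  rw [c1, c2] at h1
  rw [← h1]
  refine Eq.trans ?_ (h2.trans ?_)
  · refine lintegral_congr fun x => ?_
    congr 2
    ext y
    simp
  · congr!

lemma inv_factorial_mul_choose {n k : ℕ} (hk : k ≤ n) :
    ((n ! : ℕ) : ℝ≥0∞)⁻¹ * (n.choose k : ℝ≥0∞) =
      ((k ! : ℕ) : ℝ≥0∞)⁻¹ * (((n - k) ! : ℕ) : ℝ≥0∞)⁻¹ := by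
  have h0 : ∀ m : ℕ, ((m ! : ℕ) : ℝ≥0∞) ≠ 0 := fun m => by exact_mod_cast m.factorial_ne_zero
  have ht : ∀ m : ℕ, ((m ! : ℕ) : ℝ≥0∞) ≠ ∞ := fun m => ENNReal.natCast_ne_top _
  rw [← ENNReal.mul_inv (Or.inl (h0 _)) (Or.inl (ht _)), ← Nat.choose_mul_factorial_mul_factorial hk]
  push_cast
  rw [mul_assoc, ENNReal.mul_inv (Or.inr (ENNReal.mul_ne_top (ht _) (ht _)))
    (Or.inl (ENNReal.natCast_ne_top _)), mul_comm, ← mul_assoc, ENNReal.mul_inv_cancel, one_mul]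
  · exact_mod_cast (Nat.choose_pos hk).ne'
  · exact ENNReal.natCast_ne_top _

lemma tsum_sum_antidiagonal_mul (a b : ℕ → ℝ≥0∞) :
    ∑' n, ∑ kl ∈ Finset.HasAntidiagonal.antidiagonal n, a kl.1 * b kl.2 = (∑' n, a n) * ∑' n, b n := by
  rw [← ENNReal.tsum_mul_right]
  simp_rw [← ENNReal.tsum_mul_left]
  rw [← ENNReal.tsum_prod (f := fun k l => a k * b l),
    ← Finset.HasAntidiagonal.sigmaAntidiagonalEquivProd.tsum_eq, ENNReal.tsum_sigma']
  refine tsum_congr fun n => ?_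
  rw [tsum_fintype]
  simp only [Finset.HasAntidiagonal.sigmaAntidiagonalEquivProd_apply]
  rw [Finset.sum_coe_sort (Finset.HasAntidiagonal.antidiagonal n) fun kl => a kl.1 * b kl.2]

/-- The set integral of a product of a function of the points with a property `p` and a function of
the points without it factorises. -/
lemma lintegral_filterSet_mul {g h : FinSet α → ℝ≥0∞} (hg : Measurable g) (hh : Measurable h)
    {p : α → Prop} [DecidablePred p] (hp : MeasurableSet {y | p y})
    (hg0 : ∀ S, (∃ y ∈ S.points, ¬ p y) → g S = 0) (hh0 : ∀ S, (∃ y ∈ S.points, p y) → h S = 0) :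
    ∫⁻ S, g (filterSet p S) * h (filterSet (fun y => ¬ p y) S) ∂setMeasure α =
      (∫⁻ S, g S ∂setMeasure α) * ∫⁻ S, h S ∂setMeasure α := by
  have hg1 := hg.comp (measurable_filterSet hp)
  have hh1 := hh.comp (measurable_filterSet (p := fun y => ¬ p y) hp.compl)
  have hm : Measurable fun S => g (filterSet p S) * h (filterSet (fun y => ¬ p y) S) := hg1.mul hh1
  rw [lintegral_setMeasure hm, lintegral_setMeasure hg, lintegral_setMeasure hh,
    ← tsum_sum_antidiagonal_mul]
  refine tsum_congr fun n => ?_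
  have key : ∀ x : Fin n → α, g (filterSet p (toSet x)) * h (filterSet (fun y => ¬ p y) (toSet x)) =
      ∑ J : Finset (Fin n), g (rangeSet fun j : {j // j ∈ J} => x j) *
        h (rangeSet fun j : {j // j ∈ Jᶜ} => x j) := by
    intro x
    rw [Finset.sum_eq_single (Finset.univ.filter fun i => p (x i))]
    · rw [← rangeSet_eq_toSet, ← filterSet_rangeSet p x _ (by simp),
        ← filterSet_rangeSet (fun y => ¬ p y) x _ (by simp)]
    · intro J _ hJ
      have : ∃ i, ¬ (i ∈ J ↔ p (x i)) := by
        by_contra hc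
        push Not at hc
        exact hJ (by ext i; simp [hc i])
      obtain ⟨i, hi⟩ := this
      by_cases hiJ : i ∈ J
      · rw [hg0 _ ⟨x i, by simpa using ⟨i, hiJ, rfl⟩, by simpa [hiJ] using hi⟩, zero_mul]
      · rw [hh0 _ ⟨x i, by simpa using ⟨i, hiJ, rfl⟩, by simpa [hiJ] using hi⟩, mul_zero]
    · simp
  have hmeas : ∀ (k : FinSet α → ℝ≥0∞), Measurable k → ∀ J : Finset (Fin n),
      Measurable fun x : Fin n → α => k (rangeSet fun j : {j // j ∈ J} => x j) := fun k hk J =>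
    (measurable_comp_rangeSet (H := Unit) (.of_measurable hk)).comp
      (measurable_const.prodMk (measurable_pi_lambda _ fun j => by fun_prop) :
        Measurable fun x : Fin n → α => ((), fun j : {j // j ∈ J} => x j))
  simp_rw [key]
  rw [lintegral_finsetSum (f := fun (J : Finset (Fin n)) (x : Fin n → α) =>
    g (rangeSet fun j : {j // j ∈ J} => x j) * h (rangeSet fun j : {j // j ∈ Jᶜ} => x j)) _
    fun J _ => (hmeas g hg J).mul (hmeas h hh Jᶜ)]
  simp_rw [lintegral_mul_rangeSet hg hh]
  rw [← Finset.powerset_univ, Finset.sum_powerset_apply_card (fun k =>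
    (∫⁻ x : Fin k → α, g (toSet x) ∂Measure.pi (fun _ => volume)) *
        ∫⁻ x : Fin (n - k) → α, h (toSet x) ∂Measure.pi (fun _ => volume)),
    Finset.Nat.sum_antidiagonal_eq_sum_range_succ_mk, Finset.mul_sum, Finset.card_univ,
    Fintype.card_fin]
  refine Finset.sum_congr rfl fun k hk => ?_
  rw [nsmul_eq_mul, ← mul_assoc, inv_factorial_mul_choose (by simpa [Nat.lt_succ_iff] using hk)]
  ring

end Integral

section Campbell

variable {α : Type*} [MeasureSpace α] [SigmaFinite (volume : Measure α)]

lemma lintegral_pi_prod {n : ℕ} {f : Fin n → α → ℝ≥0∞} (hf : ∀ i, Measurable (f i)) :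
    ∫⁻ x : Fin n → α, ∏ i, f i (x i) ∂Measure.pi (fun _ => volume) = ∏ i, ∫⁻ y, f i y := by
  induction n with
  | zero => simp
  | succ n ih =>
    have hmp := measurePreserving_piFinSuccAbove (fun _ : Fin (n + 1) => (volume : Measure α)) 0
    have h1 := hmp.lintegral_comp_emb (MeasurableEquiv.measurableEmbedding _)
      fun z => f 0 z.1 * ∏ i : Fin n, f i.succ (z.2 i)
    have h2 : Measurable fun x : Fin n → α => ∏ i : Fin n, f i.succ (x i) :=
      Finset.measurable_fun_prod _ fun i _ => (hf i.succ).comp (measurable_pi_apply i)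
    have h3 := lintegral_prod_mul (μ := (volume : Measure α))
      (ν := Measure.pi fun _ : Fin n => (volume : Measure α)) (hf 0).aemeasurable h2.aemeasurable
    rw [Fin.prod_univ_succ, ← ih fun i => hf i.succ, ← h3, ← h1]
    refine lintegral_congr fun x => ?_
    rw [Fin.prod_univ_succ]
    simp [Fin.tail]

lemma tsum_inv_factorial_mul_pow {A : ℝ≥0∞} (hA : A ≠ ∞) :
    ∑' n : ℕ, ((n ! : ℕ) : ℝ≥0∞)⁻¹ * A ^ n = ENNReal.ofReal (Real.exp A.toReal) := by
  rw [Real.exp_eq_exp_ℝ, NormedSpace.exp_eq_tsum_div, ENNReal.ofReal_tsum_of_nonneg]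
  · refine tsum_congr fun n => ?_
    rw [ENNReal.ofReal_div_of_pos (by positivity), ENNReal.ofReal_pow ENNReal.toReal_nonneg,
      ENNReal.ofReal_toReal hA, ENNReal.ofReal_natCast, ENNReal.div_eq_inv_mul]
  · intro n; positivity
  · exact Real.summable_pow_div_factorial _

variable [NullSingletonClass (volume : Measure α)] [MeasurableEq α]

lemma lintegral_prod_points {a : α → ℝ≥0∞} (ha : Measurable a) (hai : ∫⁻ y, a y ≠ ∞) :
    ∫⁻ S, ∏ y ∈ S.points, a y ∂setMeasure α = ENNReal.ofReal (Real.exp (∫⁻ y, a y).toReal) := by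
  rw [lintegral_setMeasure (measurable_prod_points ha), ← tsum_inv_factorial_mul_pow hai]
  refine tsum_congr fun n => ?_
  congr 1
  have : ∫⁻ x : Fin n → α, ∏ y ∈ (toSet x).points, a y ∂Measure.pi (fun _ => volume) =
      ∫⁻ x : Fin n → α, ∏ i, a (x i) ∂Measure.pi (fun _ => volume) := by
    refine lintegral_congr_ae ?_
    filter_upwards [ae_injective n] with x hx using prod_points_toSet_of_injective hx a
  rw [this, lintegral_pi_prod fun _ => ha]
  simp

lemma lintegral_sum_mul_prod_points {a h : α → ℝ≥0∞} (ha : Measurable a) (hh : Measurable h)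
    (hai : ∫⁻ y, a y ≠ ∞) :
    ∫⁻ S, (∑ y ∈ S.points, h y) * ∏ y ∈ S.points, a y ∂setMeasure α =
      (∫⁻ y, h y * a y) * ENNReal.ofReal (Real.exp (∫⁻ y, a y).toReal) := by
  have hm : Measurable fun S : FinSet α => (∑ y ∈ S.points, h y) * ∏ y ∈ S.points, a y :=
    (measurable_sum_points hh).mul (measurable_prod_points ha)
  rw [lintegral_setMeasure hm]
  have level : ∀ n : ℕ,
      ∫⁻ x : Fin n → α, (∑ y ∈ (toSet x).points, h y) * ∏ y ∈ (toSet x).points, a y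
        ∂Measure.pi (fun _ => volume) =
      n * ((∫⁻ y, h y * a y) * (∫⁻ y, a y) ^ (n - 1)) := by
    intro n
    have h1 : ∫⁻ x : Fin n → α, (∑ y ∈ (toSet x).points, h y) * ∏ y ∈ (toSet x).points, a y
          ∂Measure.pi (fun _ => volume) =
        ∫⁻ x : Fin n → α, ∑ j, ∏ i, Function.update (fun _ => a) j (h * a) i (x i)
          ∂Measure.pi (fun _ => volume) := by
      refine lintegral_congr_ae ?_
      filter_upwards [ae_injective n] with x hx
      rw [prod_points_toSet_of_injective hx, sum_points_toSet_of_injective hx, Finset.sum_mul]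
      refine Finset.sum_congr rfl fun j _ => ?_
      rw [← Finset.mul_prod_erase _ _ (Finset.mem_univ j),
        ← Finset.mul_prod_erase _ (fun i => Function.update (fun _ => a) j (h * a) i (x i))
          (Finset.mem_univ j), ← mul_assoc]
      congr 1
      · simp
      · refine Finset.prod_congr rfl fun i hi => ?_
        rw [Function.update_of_ne (Finset.ne_of_mem_erase hi)]
    have hm : ∀ j i : Fin n, Measurable (Function.update (fun _ : Fin n => a) j (h * a) i) := by
      intro j i
      by_cases hij : i = j
      · subst hij; simpa using hh.mul ha
      · simpa [Function.update_of_ne hij] using ha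
    rw [h1, lintegral_finsetSum (f := fun (j : Fin n) (x : Fin n → α) =>
      ∏ i, Function.update (fun _ => a) j (h * a) i (x i)) _ fun j _ =>
        Finset.measurable_fun_prod _ fun i _ => (hm j i).comp (measurable_pi_apply i)]
    have h2 : ∀ j : Fin n, ∫⁻ x : Fin n → α, ∏ i, Function.update (fun _ => a) j (h * a) i (x i)
        ∂Measure.pi (fun _ => volume) = (∫⁻ y, h y * a y) * (∫⁻ y, a y) ^ (n - 1) := by
      intro j
      rw [lintegral_pi_prod (hm j), ← Finset.mul_prod_erase _ _ (Finset.mem_univ j)]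
      congr 1
      · simp
      · rw [Finset.prod_congr rfl fun i hi => by
          rw [Function.update_of_ne (Finset.ne_of_mem_erase hi)]]
        simp
    simp [h2]
  simp_rw [level]
  rw [tsum_eq_zero_add' ENNReal.summable, ← tsum_inv_factorial_mul_pow hai, ← ENNReal.tsum_mul_left]
  simp only [Nat.cast_zero, zero_mul, mul_zero, zero_add, Nat.add_sub_cancel]
  refine tsum_congr fun n => ?_
  have h0 : ((n + 1 : ℕ) : ℝ≥0∞) ≠ 0 := by positivity
  rw [Nat.factorial_succ, Nat.cast_mul, ENNReal.mul_inv (Or.inl h0)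
    (Or.inl (ENNReal.natCast_ne_top _))]
  calc _ = (((n + 1 : ℕ) : ℝ≥0∞)⁻¹ * ((n + 1 : ℕ) : ℝ≥0∞)) * ((n ! : ℕ) : ℝ≥0∞)⁻¹ *
        ((∫⁻ y, h y * a y) * (∫⁻ y, a y) ^ n) := by ring
    _ = _ := by
      rw [ENNReal.inv_mul_cancel h0 (ENNReal.natCast_ne_top _)]; ring

end Campbell

section Parameter

variable {α H : Type*} [MeasureSpace α] [MeasurableSpace H] {P : Measure H}
  {g : H → FinSet α → ℝ≥0∞}

lemma JointlyMeasurable.measurable_param (hg : JointlyMeasurable g) (S : FinSet α) :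
    Measurable fun η => g η S := by
  have : S = toSet fun k => (S.points.equivFin.symm k : α) := by
    ext y
    rw [mem_toSet]
    constructor
    · exact fun hy => ⟨S.points.equivFin ⟨y, hy⟩, by simp⟩
    · rintro ⟨k, rfl⟩
      exact (S.points.equivFin.symm k).2
  rw [this]
  exact (hg _).comp measurable_prodMk_right

variable [SFinite P]

lemma JointlyMeasurable.measurable_lintegral (hg : JointlyMeasurable g) :
    Measurable fun S => ∫⁻ η, g η S ∂P :=
  measurable_finSet_iff.2 fun n => (hg n).lintegral_prod_left'

variable [SigmaFinite (volume : Measure α)]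

lemma JointlyMeasurable.lintegral_swap (hg : JointlyMeasurable g) :
    ∫⁻ S, ∫⁻ η, g η S ∂P ∂setMeasure α = ∫⁻ η, ∫⁻ S, g η S ∂setMeasure α ∂P := by
  simp_rw [lintegral_setMeasure (hg.measurable _)]
  rw [lintegral_setMeasure hg.measurable_lintegral, lintegral_tsum fun n =>
    ((hg n).lintegral_prod_right'.const_mul _).aemeasurable]
  refine tsum_congr fun n => ?_
  rw [lintegral_const_mul _ (hg n).lintegral_prod_right']
  congr 1
  exact lintegral_lintegral_swap ((hg n).comp measurable_swap).aemeasurable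

lemma JointlyMeasurable.lintegral_mul_swap (hg : JointlyMeasurable g) {w : FinSet α → ℝ≥0∞}
    (hw : Measurable w) :
    ∫⁻ S, w S * ∫⁻ η, g η S ∂P ∂setMeasure α =
      ∫⁻ η, ∫⁻ S, w S * g η S ∂setMeasure α ∂P := by
  rw [← JointlyMeasurable.lintegral_swap ((JointlyMeasurable.of_measurable hw).mul hg)]
  refine lintegral_congr fun S => ?_
  rw [lintegral_const_mul _ (hg.measurable_param S)]

end Parameter

section Labels

variable {I : ℕ} {X : Type*}

lemma slice_eq_filterSet (u : Fin (I + 1)) (S : FinSet (Aug I X)) :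
    slice u S = filterSet (fun y => y.1 = u) S := rfl

/-- The product `∏ᵤ gᵤ(Sᵘ)` over all labels. -/
noncomputable def labelProduct (g : Fin (I + 1) → FinSet (Aug I X) → ℝ≥0∞) (S : FinSet (Aug I X)) :
    ℝ≥0∞ :=
  ∏ u, g u (slice u S)

lemma productDensity_eq_labelProduct (gU : FinSet (Aug I X) → ℝ≥0∞)
    (g : Fin I → FinSet (Aug I X) → ℝ≥0∞) :
    productDensity gU g = labelProduct (Fin.cons gU g) := by
  ext S
  simp [productDensity, labelProduct, Fin.prod_univ_succ]

variable [MeasureSpace X]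

instance [MeasurableEq X] : MeasurableEq (Aug I X) where
  measurableSet_diagonal := by
    have : Set.diagonal (Aug I X) = {z | z.1.1 = z.2.1} ∩ {z | z.1.2 = z.2.2} := by
      ext z
      simp [Prod.ext_iff]
    rw [this]
    exact (measurableSet_eq_fun (by fun_prop) (by fun_prop)).inter
      (measurableSet_eq_fun (by fun_prop) (by fun_prop))

lemma volume_aug : (volume : Measure (Aug I X)) = Measure.count.prod volume := rfl

lemma measurableSet_label (u : Fin (I + 1)) : MeasurableSet {y : Aug I X | y.1 = u} :=
  measurable_fst (measurableSet_singleton u)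

lemma measurable_slice (u : Fin (I + 1)) :
    Measurable (slice u : FinSet (Aug I X) → FinSet (Aug I X)) :=
  measurable_filterSet (measurableSet_label u)

lemma measurable_labelProduct {g : Fin (I + 1) → FinSet (Aug I X) → ℝ≥0∞}
    (hg : ∀ u, Measurable (g u)) : Measurable (labelProduct g) :=
  Finset.measurable_fun_prod _ fun u _ => (hg u).comp (measurable_slice u)

lemma jointlyMeasurable_labelProduct {H : Type*} [MeasurableSpace H]
    {G : Fin (I + 1) → H → FinSet (Aug I X) → ℝ≥0∞} (hJ : ∀ u, JointlyMeasurable (G u)) :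
    JointlyMeasurable fun η => labelProduct fun u => G u η :=
  JointlyMeasurable.prod fun u => (hJ u).comp_filterSet (measurableSet_label u)

lemma lintegral_ite_empty :
    ∫⁻ S : FinSet (Aug I X), (if ∀ y ∈ S.points, y.1 ∈ (∅ : Finset (Fin (I + 1))) then 1 else 0)
      ∂setMeasure (Aug I X) = 1 := by
  classical
  rw [lintegral_setMeasure (Measurable.ite (measurableSet_forall_mem (by simp))
    measurable_const measurable_const), tsum_eq_single 0]
  · simp
  · intro n hn
    have : ∀ x : Fin n → Aug I X, ¬ ∀ y ∈ (toSet x).points, y.1 ∈ (∅ : Finset (Fin (I + 1))) := by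
      intro x hx
      obtain ⟨m, rfl⟩ := Nat.exists_eq_succ_of_ne_zero hn
      exact absurd (hx (x 0) (by simp)) (Finset.notMem_empty _)
    simp only [if_neg (this _), lintegral_zero, mul_zero]

lemma ae_aug_of_ae {p : X → Prop} (h : ∀ᵐ x, p x) : ∀ᵐ y : Aug I X, p y.2 :=
  Measure.quasiMeasurePreserving_snd.ae h

variable [SigmaFinite (volume : Measure X)]

instance : SigmaFinite (volume : Measure (Aug I X)) := by
  rw [volume_aug]; infer_instance

instance [NullSingletonClass (volume : Measure X)] :
    NullSingletonClass (volume : Measure (Aug I X)) := by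
  rw [volume_aug]; infer_instance

lemma lintegral_aug {w : Aug I X → ℝ≥0∞} (hw : Measurable w) :
    ∫⁻ y, w y = ∑ u, ∫⁻ x, w (u, x) := by
  rw [volume_aug, lintegral_prod _ hw.aemeasurable, lintegral_count, tsum_fintype]

lemma lintegral_prod_slice {g : Fin (I + 1) → FinSet (Aug I X) → ℝ≥0∞}
    (hg : ∀ u, Measurable (g u)) (hg0 : ∀ u S, (∃ y ∈ S.points, y.1 ≠ u) → g u S = 0)
    (T : Finset (Fin (I + 1))) :
    ∫⁻ S, (if ∀ y ∈ S.points, y.1 ∈ T then 1 else 0) * ∏ u ∈ T, g u (slice u S)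
      ∂setMeasure (Aug I X) = ∏ u ∈ T, ∫⁻ S, g u S ∂setMeasure (Aug I X) := by
  classical
  induction T using Finset.induction_on with
  | empty => simpa using lintegral_ite_empty (I := I) (X := X)
  | insert u T hu ih =>
    set h : FinSet (Aug I X) → ℝ≥0∞ := fun S =>
      (if ∀ y ∈ S.points, y.1 ∈ T then 1 else 0) * ∏ v ∈ T, g v (slice v S) with hh
    have hm : Measurable h := by
      refine (Measurable.ite (measurableSet_forall_mem ?_) measurable_const measurable_const).mul
        (Finset.measurable_fun_prod _ fun v _ => (hg v).comp (measurable_slice v))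
      exact measurable_fst (Set.toFinite (T : Set (Fin (I + 1)))).measurableSet
    have h0 : ∀ S, (∃ y ∈ S.points, y.1 = u) → h S = 0 := by
      intro S ⟨y, hy, hyu⟩
      rw [hh]
      simp only
      rw [if_neg, zero_mul]
      exact fun h => hu (hyu ▸ h y hy)
    rw [Finset.prod_insert hu, ← ih,
      ← lintegral_filterSet_mul (hg u) hm (measurableSet_label u) (hg0 u) h0]
    refine lintegral_congr fun S => ?_
    rw [Finset.prod_insert hu, slice_eq_filterSet u S, hh]
    have h1 : (∀ y ∈ (filterSet (fun y : Aug I X => ¬ y.1 = u) S).points, y.1 ∈ T) ↔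
        ∀ y ∈ S.points, y.1 ∈ insert u T := by
      simp only [mem_filterSet, Finset.mem_insert]
      exact forall_congr' fun y => by tauto
    have h2 : ∀ v ∈ T, slice v (filterSet (fun y : Aug I X => ¬ y.1 = u) S) = slice v S := by
      intro v hv
      ext y
      simp only [slice_eq_filterSet, mem_filterSet]
      constructor
      · tauto
      · rintro ⟨h, rfl⟩
        exact ⟨⟨h, fun h' => hu (h' ▸ hv)⟩, rfl⟩
    have h3 : ∏ v ∈ T, g v (slice v (filterSet (fun y : Aug I X => ¬ y.1 = u) S)) =
        ∏ v ∈ T, g v (slice v S) := Finset.prod_congr rfl fun v hv => by rw [h2 v hv]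
    simp only [h3, h1]
    ring

/-- The set integral of a product over the labels factorises. -/
lemma lintegral_labelProduct {g : Fin (I + 1) → FinSet (Aug I X) → ℝ≥0∞}
    (hg : ∀ u, Measurable (g u)) (hg0 : ∀ u S, (∃ y ∈ S.points, y.1 ≠ u) → g u S = 0) :
    ∫⁻ S, labelProduct g S ∂setMeasure (Aug I X) = ∏ u, ∫⁻ S, g u S ∂setMeasure (Aug I X) := by
  simpa [labelProduct] using lintegral_prod_slice hg hg0 Finset.univ

end Labels

section LabelMixture

variable {I : ℕ} {X H : Type*} [MeasureSpace X] [SigmaFinite (volume : Measure X)]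
  [MeasurableSpace H]

/-- The average of a parametrised set function over the parameter. -/
noncomputable def mixture {α : Type*} (P : Measure H) (g : H → FinSet α → ℝ≥0∞) (S : FinSet α) :
    ℝ≥0∞ :=
  ∫⁻ η, g η S ∂P

lemma lintegral_labelProduct_eq_one {g : Fin (I + 1) → FinSet (Aug I X) → ℝ≥0∞}
    (hg : ∀ u, IsLabelledDensity u (g u)) :
    ∫⁻ S, labelProduct g S ∂setMeasure (Aug I X) = 1 := by
  rw [lintegral_labelProduct (fun u => (hg u).measurable) fun u => (hg u).eq_zero]
  exact Finset.prod_eq_one fun u _ => (hg u).integral_eq_one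

variable {P : Measure H} [IsProbabilityMeasure P]

lemma JointlyMeasurable.measurable_mixture {α : Type*} [MeasureSpace α]
    {g : H → FinSet α → ℝ≥0∞} (hg : JointlyMeasurable g) : Measurable (mixture P g) :=
  hg.measurable_lintegral

lemma isLabelledDensity_mixture {u : Fin (I + 1)} {g : H → FinSet (Aug I X) → ℝ≥0∞}
    (hJ : JointlyMeasurable g) (hg : ∀ η, IsLabelledDensity u (g η)) :
    IsLabelledDensity u (mixture P g) where
  measurable := hJ.measurable_lintegral
  integral_eq_one := by
    simp only [mixture]
    rw [hJ.lintegral_swap]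
    simp [(hg _).integral_eq_one]
  eq_zero S hS := by simp [mixture, (hg _).eq_zero S hS]

variable {G : Fin (I + 1) → H → FinSet (Aug I X) → ℝ≥0∞}

lemma lintegral_mixture_labelProduct (hJ : ∀ u, JointlyMeasurable (G u))
    (hG : ∀ u η, IsLabelledDensity u (G u η)) :
    ∫⁻ S, mixture P (fun η => labelProduct fun u => G u η) S ∂setMeasure (Aug I X) = 1 := by
  simp only [mixture]
  rw [(jointlyMeasurable_labelProduct hJ).lintegral_swap]
  simp [lintegral_labelProduct_eq_one fun u => hG u _]

/-- The points with label `u` of a mixture of products are distributed according to the mixture of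
the `u`-th factors. -/
lemma map_slice_withDensity_mixture (hJ : ∀ u, JointlyMeasurable (G u))
    (hG : ∀ u η, IsLabelledDensity u (G u η)) (u : Fin (I + 1)) :
    ((setMeasure (Aug I X)).withDensity
        (mixture P fun η => labelProduct fun u => G u η)).map (slice u) =
      (setMeasure (Aug I X)).withDensity (mixture P (G u)) := by
  ext s hs
  have hL := jointlyMeasurable_labelProduct hJ
  set w : FinSet (Aug I X) → ℝ≥0∞ := s.indicator 1 with hw
  have hwm : Measurable w := measurable_one.indicator hs
  have hpre := measurable_slice (I := I) (X := X) u hs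
  have key : ∀ η, ∫⁻ S, w (slice u S) * labelProduct (fun u => G u η) S ∂setMeasure (Aug I X) =
      ∫⁻ S, w S * G u η S ∂setMeasure (Aug I X) := by
    intro η
    have h1 := lintegral_labelProduct
      (g := Function.update (fun v => G v η) u fun S => w S * G u η S) (fun v => by
        by_cases hv : v = u
        · subst hv; simpa [Pi.mul_def] using hwm.mul (hG v η).measurable
        · simpa [Function.update_of_ne hv] using (hG v η).measurable) (fun v S hS => by
        by_cases hv : v = u
        · subst hv; simp [(hG v η).eq_zero S hS]
        · simp [Function.update_of_ne hv, (hG v η).eq_zero S hS])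
    rw [← Finset.mul_prod_erase _ _ (Finset.mem_univ u), Finset.prod_eq_one, mul_one] at h1
    · simp only [Function.update_self] at h1
      rw [← h1]
      refine lintegral_congr fun S => ?_
      rw [labelProduct, labelProduct, ← Finset.mul_prod_erase _ _ (Finset.mem_univ u),
        ← Finset.mul_prod_erase _ _ (Finset.mem_univ u), ← mul_assoc]
      congr 1
      · simp
      · refine Finset.prod_congr rfl fun v hv => ?_
        rw [Function.update_of_ne (Finset.ne_of_mem_erase hv)]
    · intro v hv
      rw [Function.update_of_ne (Finset.ne_of_mem_erase hv)]
      exact (hG v η).integral_eq_one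
  rw [Measure.map_apply (measurable_slice u) hs, withDensity_apply _ hpre, withDensity_apply _ hs,
    ← lintegral_indicator hpre, ← lintegral_indicator hs]
  have e1 : ∀ S, (slice u ⁻¹' s).indicator (mixture P fun η => labelProduct fun u => G u η) S =
      w (slice u S) * mixture P (fun η => labelProduct fun u => G u η) S := by
    intro S
    by_cases h : slice u S ∈ s <;> simp [hw, h]
  have e2 : ∀ S, s.indicator (mixture P (G u)) S = w S * mixture P (G u) S := by
    intro S
    by_cases h : S ∈ s <;> simp [hw, h]
  simp_rw [e1, e2, mixture]
  have hwm' : Measurable fun S => w (slice u S) := hwm.comp (measurable_slice u)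
  rw [hL.lintegral_mul_swap hwm', (hJ u).lintegral_mul_swap hwm]
  exact lintegral_congr key

/-- The divergence of a product density from a density with marginals `rᵤ` splits into the
divergence of the product of the marginals and the divergences of the factors. -/
lemma setKLD_labelProduct_eq_add {f : FinSet (Aug I X) → ℝ≥0∞} (hfm : Measurable f)
    (hf1 : ∫⁻ S, f S ∂setMeasure (Aug I X) = 1)
    {r g : Fin (I + 1) → FinSet (Aug I X) → ℝ≥0∞} (hr : ∀ u, IsLabelledDensity u (r u))
    (hg : ∀ u, IsLabelledDensity u (g u))
    (hmap : ∀ u, ((setMeasure (Aug I X)).withDensity f).map (slice u) =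
      (setMeasure (Aug I X)).withDensity (r u)) :
    setKLD f (labelProduct g) = setKLD f (labelProduct r) + ∑ u, setKLD (r u) (g u) := by
  have hgm := measurable_labelProduct fun u => (hg u).measurable
  have hrm := measurable_labelProduct fun u => (hr u).measurable
  have hg1 := lintegral_labelProduct_eq_one hg
  have hr1 := lintegral_labelProduct_eq_one hr
  have top : ∀ {h : FinSet (Aug I X) → ℝ≥0∞}, ∫⁻ S, h S ∂setMeasure (Aug I X) = 1 →
      ∫⁻ S, h S ∂setMeasure (Aug I X) ≠ ∞ := fun h => by rw [h]; exact ENNReal.one_ne_top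
  set p := (setMeasure (Aug I X)).withDensity f with hp
  have hpull : ∀ u {Q : FinSet (Aug I X) → Prop},
      (∀ᵐ S ∂(setMeasure (Aug I X)).withDensity (r u), Q S) → ∀ᵐ S ∂p, Q (slice u S) := by
    intro u Q hQ
    rw [← hmap u] at hQ
    exact ae_of_ae_map (measurable_slice u).aemeasurable hQ
  have hr0 : ∀ᵐ S ∂p, ∀ u, r u (slice u S) ≠ 0 ∧ r u (slice u S) < ∞ := by
    rw [ae_all_iff]
    exact fun u => hpull u (Q := fun S => r u S ≠ 0 ∧ r u S < ∞)
      ((ae_withDensity_ne_zero (hr u).measurable).and (ae_withDensity_lt_top (hr u).measurable (top (hr u).integral_eq_one)))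
  have hgt : ∀ᵐ S ∂p, ∀ u, g u (slice u S) < ∞ := by
    rw [ae_all_iff]
    exact fun u => hpull u (Q := fun S => g u S < ∞)
      (ae_withDensity_lt_top (hg u).measurable (top (hg u).integral_eq_one))
  have hr0' : ∀ᵐ S ∂p, labelProduct r S ≠ 0 := by
    filter_upwards [hr0] with S hS
    exact Finset.prod_ne_zero_iff.2 fun u _ => (hS u).1
  set w : Fin (I + 1) → FinSet (Aug I X) → ℝ := fun u S => logRatio (r u) (g u) (slice u S) with hw
  have hwm : ∀ u, Measurable (logRatio (r u) (g u)) := fun u =>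
    measurable_logRatio (hr u).measurable (hg u).measurable
  have hlog : (∀ᵐ S ∂p, ∀ u, g u (slice u S) ≠ 0) →
      logRatio (labelProduct r) (labelProduct g) =ᵐ[p] fun S => ∑ u, w u S := by
    intro hg0
    filter_upwards [hr0, hgt, hg0] with S h1 h2 h3
    have aux : ∀ k : Fin (I + 1) → FinSet (Aug I X) → ℝ≥0∞,
        (∀ u, k u (slice u S) ≠ 0 ∧ k u (slice u S) < ∞) →
        Real.log (labelProduct k S).toReal = ∑ u, Real.log (k u (slice u S)).toReal := by
      intro k hk
      rw [labelProduct, ENNReal.toReal_prod, Real.log_prod]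
      exact fun u _ => (ENNReal.toReal_pos (hk u).1 (hk u).2.ne).ne'
    rw [logRatio, aux r h1, aux g fun u => ⟨h3 u, h2 u⟩, ← Finset.sum_sub_distrib]
    rfl
  have hiff : ∀ u, setKLD (r u) (g u) ≠ ∞ ↔
      (∀ᵐ S ∂(setMeasure (Aug I X)).withDensity (r u), g u S ≠ 0) ∧
        Integrable (logRatio (r u) (g u)) ((setMeasure (Aug I X)).withDensity (r u)) := fun u =>
    klDiv_withDensity_ne_top_iff (hr u).measurable (hg u).measurable
      (top (hr u).integral_eq_one) (top (hg u).integral_eq_one)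
  by_cases hfin : ∀ u, setKLD (r u) (g u) ≠ ∞
  · have hg0 : ∀ᵐ S ∂p, ∀ u, g u (slice u S) ≠ 0 := by
      rw [ae_all_iff]
      exact fun u => hpull u (Q := fun S => g u S ≠ 0) ((hiff u).1 (hfin u)).1
    have hwi : ∀ u, Integrable (w u) p := by
      intro u
      have := ((hiff u).1 (hfin u)).2
      rw [← hmap u] at this
      exact (integrable_map_measure (hwm u).aestronglyMeasurable
        (measurable_slice u).aemeasurable).1 this
    have hsum : Integrable (fun S => ∑ u, w u S) p := integrable_finsetSum _ fun u _ => hwi u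
    refine klDiv_withDensity_eq_add hfm hgm hrm (top hf1) (top hg1) (top hr1) hr0' ?_
      ((integrable_congr (hlog hg0)).2 hsum) (ENNReal.sum_ne_top.2 fun u _ => hfin u) ?_
    · filter_upwards [hg0] with S hS using Finset.prod_ne_zero_iff.2 fun u _ => hS u
    · rw [ENNReal.toReal_sum fun u _ => hfin u, integral_congr_ae (hlog hg0),
        integral_finsetSum _ fun u _ => hwi u, hg1, hr1, add_sub_cancel_right]
      refine Finset.sum_congr rfl fun u _ => ?_
      rw [setKLD, toReal_klDiv_withDensity (hr u).measurable (hg u).measurable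
        (top (hr u).integral_eq_one) (top (hg u).integral_eq_one) ((hiff u).1 (hfin u)).1
        ((hiff u).1 (hfin u)).2, (hr u).integral_eq_one, (hg u).integral_eq_one,
        add_sub_cancel_right, ← hmap u,
        integral_map (measurable_slice u).aemeasurable (hwm u).aestronglyMeasurable]
  · have hsum : ∑ u, setKLD (r u) (g u) = ∞ := by
      push Not at hfin
      obtain ⟨u, hu⟩ := hfin
      exact ENNReal.sum_eq_top.2 ⟨u, Finset.mem_univ u, hu⟩
    rw [hsum, add_top]
    by_contra hne
    refine hfin fun u => (hiff u).2 ?_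
    have hg0' := ((klDiv_withDensity_ne_top_iff hfm hgm (top hf1) (top hg1)).1 hne).1
    have hg0 : ∀ᵐ S ∂p, ∀ u, g u (slice u S) ≠ 0 := by
      filter_upwards [hg0'] with S hS u using Finset.prod_ne_zero_iff.1 hS u (Finset.mem_univ u)
    have hgu0 : ∀ v, ∀ᵐ S ∂(setMeasure (Aug I X)).withDensity (r v), g v S ≠ 0 := by
      intro v
      rw [← hmap v, ae_map_iff (measurable_slice v).aemeasurable
        (p := fun S => g v S ≠ 0) ((hg v).measurable (measurableSet_singleton 0)).compl]
      exact (ae_all_iff.1 hg0) v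
    have hpos := lintegral_ofReal_logRatio_lt_top hfm hgm hrm (top hf1) (top hg1) (top hr1) hr0' hne
    have hneg : ∀ v, ∫⁻ S, ENNReal.ofReal (-w v S) ∂p < ∞ := by
      intro v
      have := lintegral_ofReal_neg_logRatio_lt_top (hr v).measurable (hg v).measurable
        (top (hr v).integral_eq_one) (top (hg v).integral_eq_one) (hgu0 v)
      rwa [← hmap v, lintegral_map (measurable_ofReal_neg (hwm v)) (measurable_slice v)] at this
    have hwm' : ∀ v, Measurable (w v) := fun v => (hwm v).comp (measurable_slice v)
    have hposu : ∫⁻ S, ENNReal.ofReal (w u S) ∂p < ∞ := by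
      calc ∫⁻ S, ENNReal.ofReal (w u S) ∂p
          ≤ ∫⁻ S, (ENNReal.ofReal (logRatio (labelProduct r) (labelProduct g) S) +
              ∑ v ∈ Finset.univ.erase u, ENNReal.ofReal (-w v S)) ∂p := by
            refine lintegral_mono_ae ?_
            filter_upwards [hlog hg0] with S hS
            have h1 : w u S = logRatio (labelProduct r) (labelProduct g) S +
                ∑ v ∈ Finset.univ.erase u, -w v S := by
              rw [hS, ← Finset.add_sum_erase _ _ (Finset.mem_univ u), Finset.sum_neg_distrib]
              ring
            rw [h1]
            refine ENNReal.ofReal_add_le.trans (add_le_add_right ?_ _)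
            calc ENNReal.ofReal (∑ v ∈ Finset.univ.erase u, -w v S)
                ≤ ENNReal.ofReal (∑ v ∈ Finset.univ.erase u, max (-w v S) 0) :=
                  ENNReal.ofReal_le_ofReal (Finset.sum_le_sum fun v _ => le_max_left _ _)
              _ = ∑ v ∈ Finset.univ.erase u, ENNReal.ofReal (max (-w v S) 0) :=
                  ENNReal.ofReal_sum_of_nonneg fun v _ => le_max_right _ _
              _ = _ := Finset.sum_congr rfl fun v _ => by simp [ENNReal.ofReal_max]
        _ = ∫⁻ S, ENNReal.ofReal (logRatio (labelProduct r) (labelProduct g) S) ∂p +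
              ∑ v ∈ Finset.univ.erase u, ∫⁻ S, ENNReal.ofReal (-w v S) ∂p := by
            rw [lintegral_add_left (measurable_logRatio hrm hgm).ennreal_ofReal,
              lintegral_finsetSum _ fun v _ => measurable_ofReal_neg (hwm' v)]
        _ < ∞ := ENNReal.add_lt_top.2 ⟨hpos, ENNReal.sum_lt_top.2 fun v _ => hneg v⟩
    have hint := integrable_of_lintegral_ofReal (hwm' u) hposu (hneg u)
    refine ⟨hgu0 u, ?_⟩
    rw [← hmap u]
    exact (integrable_map_measure (hwm u).aestronglyMeasurable
      (measurable_slice u).aemeasurable).2 hint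

lemma setKLD_eq_zero_iff {α : Type*} [MeasureSpace α] {f g : FinSet α → ℝ≥0∞} (hf : Measurable f)
    (hg : Measurable g) (hfi : ∫⁻ S, f S ∂setMeasure α ≠ ∞) (hgi : ∫⁻ S, g S ∂setMeasure α ≠ ∞) :
    setKLD f g = 0 ↔ f =ᵐ[setMeasure α] g := by
  have : IsFiniteMeasure ((setMeasure α).withDensity f) := isFiniteMeasure_withDensity hfi
  have : IsFiniteMeasure ((setMeasure α).withDensity g) := isFiniteMeasure_withDensity hgi
  rw [setKLD, klDiv_eq_zero_iff, withDensity_eq_iff hf.aemeasurable hg.aemeasurable hfi]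

end LabelMixture

namespace PMB

variable {I : ℕ} {X : Type*} [MeasureSpace X]

/-- The Poisson intensity, regarded as an intensity of landmarks labelled `0`. -/
noncomputable def labelledIntensity (q : PMB I X) (y : Aug I X) : ℝ≥0∞ :=
  if y.1 = 0 then q.intensity y.2 else 0

lemma poissonFactor_eq (q : PMB I X) (S : FinSet (Aug I X)) :
    q.poissonFactor S = ENNReal.ofReal (Real.exp (-(∫⁻ x, q.intensity x).toReal)) *
      ∏ y ∈ S.points, q.labelledIntensity y := rfl

lemma measurable_labelledIntensity (q : PMB I X) : Measurable q.labelledIntensity :=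
  Measurable.ite (measurableSet_label 0) (q.measurable_intensity.comp measurable_snd)
    measurable_const

lemma poissonFactor_ne_zero_iff (q : PMB I X) (S : FinSet (Aug I X)) :
    q.poissonFactor S ≠ 0 ↔ ∀ y ∈ S.points, y.1 = 0 ∧ q.intensity y.2 ≠ 0 := by
  rw [poissonFactor_eq, mul_ne_zero_iff, Finset.prod_ne_zero_iff]
  simp [labelledIntensity, Real.exp_pos]

lemma log_poissonFactor (q : PMB I X) (S : FinSet (Aug I X))
    (h : ∀ y ∈ S.points, y.1 = 0 ∧ q.intensity y.2 ≠ 0 ∧ q.intensity y.2 < ∞) :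
    Real.log (q.poissonFactor S).toReal = -(∫⁻ x, q.intensity x).toReal +
      ∑ y ∈ S.points, Real.log (q.intensity y.2).toReal := by
  have h1 : ∏ y ∈ S.points, q.labelledIntensity y = ∏ y ∈ S.points, q.intensity y.2 :=
    Finset.prod_congr rfl fun y hy => by simp [labelledIntensity, (h y hy).1]
  have h2 : ∀ y ∈ S.points, (q.intensity y.2).toReal ≠ 0 := fun y hy =>
    (ENNReal.toReal_pos (h y hy).2.1 (h y hy).2.2.ne).ne'
  rw [poissonFactor_eq, h1, ENNReal.toReal_mul, ENNReal.toReal_prod,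
    ENNReal.toReal_ofReal (Real.exp_pos _).le, Real.log_mul (Real.exp_pos _).ne'
      (Finset.prod_ne_zero_iff.2 h2), Real.log_exp, Real.log_prod h2]

lemma isMeasurableFamily_const (q : PMB I X) : IsMeasurableFamily fun _ : Unit => q where
  intensity := q.measurable_intensity.comp measurable_snd
  existProb _ := measurable_const
  spatial i := (q.measurable_spatial i).comp measurable_snd

lemma bernoulliFactor_eq_zero (q : PMB I X) (i : Fin I) (S : FinSet (Aug I X))
    (hS : ∃ y ∈ S.points, y.1 ≠ i.succ) : q.bernoulliFactor i S = 0 := by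
  obtain ⟨y, hy, hyi⟩ := hS
  have h0 : S.points.card ≠ 0 := Finset.card_ne_zero_of_mem hy
  rw [bernoulliFactor, if_neg h0]
  by_cases h1 : S.points.card = 1
  · obtain ⟨z, hz⟩ := Finset.card_eq_one.1 h1
    rw [hz, Finset.mem_singleton] at hy
    subst hy
    simp [hz, hyi]
  · rw [if_neg h1]

lemma bernoulliFactor_toSet_zero (q : PMB I X) (i : Fin I) (x : Fin 0 → Aug I X) :
    q.bernoulliFactor i (toSet x) = 1 - q.existProb i := by
  have : (toSet x).points = ∅ := by ext y; simp
  simp [bernoulliFactor, this]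

lemma bernoulliFactor_toSet_one (q : PMB I X) (i : Fin I) (x : Fin 1 → Aug I X) :
    q.bernoulliFactor i (toSet x) =
      if (x 0).1 = i.succ then q.existProb i * q.spatial i (x 0).2 else 0 := by
  have : (toSet x).points = {x 0} := by ext y; simp [eq_comm]
  simp [bernoulliFactor, this]

lemma bernoulliFactor_toSet_of_injective (q : PMB I X) (i : Fin I) {n : ℕ} (hn : 2 ≤ n)
    {x : Fin n → Aug I X} (hx : Function.Injective x) : q.bernoulliFactor i (toSet x) = 0 := by
  have : (toSet x).points.card = n := by
    rw [Finset.card_eq_sum_ones, sum_points_toSet_of_injective hx]; simp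
  rw [bernoulliFactor, if_neg (by omega), if_neg (by omega)]

/-- The average of the Poisson intensities. -/
noncomputable def meanIntensity {H : Type*} [MeasurableSpace H] (P : Measure H)
    (F : H → PMB I X) (x : X) : ℝ≥0∞ :=
  ∫⁻ η, (F η).intensity x ∂P

lemma measurable_meanIntensity {H : Type*} [MeasurableSpace H] {P : Measure H} [SFinite P]
    {F : H → PMB I X} (hF : IsMeasurableFamily F) : Measurable (meanIntensity P F) :=
  hF.intensity.lintegral_prod_left'

lemma poissonFactor_congr_ae [SigmaFinite (volume : Measure X)] {q q' : PMB I X} 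
    (h : q.intensity =ᵐ[volume] q'.intensity) :
    q.poissonFactor =ᵐ[setMeasure _] q'.poissonFactor := by
  filter_upwards [ae_forall_mem (ae_aug_of_ae (I := I) h)] with S hS
  rw [poissonFactor_eq, poissonFactor_eq, lintegral_congr_ae h]
  congr 1
  exact Finset.prod_congr rfl fun y hy => by simp [labelledIntensity, hS y hy]

section Bernoulli

variable {H : Type*} [MeasurableSpace H] [MeasurableEq X] {F : H → PMB I X}

lemma jointlyMeasurable_bernoulliFactor (hF : IsMeasurableFamily F) (i : Fin I) :
    JointlyMeasurable fun η => (F η).bernoulliFactor i := by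
  have hs : JointlyMeasurable fun η (S : FinSet (Aug I X)) => ∑ y ∈ S.points,
      if y.1 = i.succ then (F η).existProb i * (F η).spatial i y.2 else 0 := by
    refine jointlyMeasurable_sum_points (h := fun η (y : Aug I X) =>
      if y.1 = i.succ then (F η).existProb i * (F η).spatial i y.2 else 0) ?_
    refine Measurable.ite (measurable_snd (measurableSet_label i.succ)) ?_ measurable_const
    exact ((hF.existProb i).comp measurable_fst).mul
      ((hF.spatial i).comp (by fun_prop : Measurable fun p : H × Aug I X => (p.1, p.2.2)))
  intro n
  have hc : Measurable fun p : H × (Fin n → Aug I X) => (toSet p.2).points.card :=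
    (measurable_finSet_iff.1 measurable_card_points n).comp measurable_snd
  refine Measurable.ite (hc (measurableSet_singleton 0))
    (measurable_const.sub ((hF.existProb i).comp measurable_fst))
    (Measurable.ite (hc (measurableSet_singleton 1)) (hs n) measurable_const)

variable [SigmaFinite (volume : Measure X)] [NullSingletonClass (volume : Measure X)]

lemma isLabelledDensity_bernoulliFactor (q : PMB I X) (i : Fin I) :
    IsLabelledDensity i.succ (q.bernoulliFactor i) where
  measurable := (jointlyMeasurable_bernoulliFactor q.isMeasurableFamily_const i).measurable ()
  eq_zero := q.bernoulliFactor_eq_zero i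
  integral_eq_one := by
    rw [lintegral_setMeasure
      ((jointlyMeasurable_bernoulliFactor q.isMeasurableFamily_const i).measurable ()),
      tsum_eq_sum (s := Finset.range 2), Finset.sum_range_succ, Finset.sum_range_one]
    · have h1 : ∫⁻ x : Fin 1 → Aug I X, q.bernoulliFactor i (toSet x)
          ∂Measure.pi (fun _ => volume) = q.existProb i := by
        have hm : Measurable fun y : Aug I X =>
            if y.1 = i.succ then q.existProb i * q.spatial i y.2 else 0 :=
          Measurable.ite (measurableSet_label i.succ)
            (((q.measurable_spatial i).comp measurable_snd).const_mul _) measurable_const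
        have h2 := lintegral_pi_prod (n := 1) fun _ => hm
        simp only [Fin.prod_univ_one] at h2
        simp_rw [bernoulliFactor_toSet_one]
        rw [h2, lintegral_aug hm, Finset.sum_eq_single i.succ]
        · simp [lintegral_const_mul _ (q.measurable_spatial i), q.spatial_integral i]
        · intro u _ hu; simp [hu]
        · simp
      simp_rw [h1, bernoulliFactor_toSet_zero]
      simp [tsub_add_cancel_of_le (q.existProb_le_one i)]
    · intro n hn
      have h2 : 2 ≤ n := not_lt.1 fun h => hn (Finset.mem_range.2 h)
      have : ∫⁻ x : Fin n → Aug I X, q.bernoulliFactor i (toSet x)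
          ∂Measure.pi (fun _ => volume) = 0 := by
        rw [lintegral_eq_zero_iff' (measurable_finSet_iff.1 ((jointlyMeasurable_bernoulliFactor
          q.isMeasurableFamily_const i).measurable ()) n).aemeasurable]
        filter_upwards [ae_injective n] with x hx
          using q.bernoulliFactor_toSet_of_injective i h2 hx
      rw [this, mul_zero]

end Bernoulli

section Poisson

variable {H : Type*} [MeasurableSpace H] [SigmaFinite (volume : Measure X)] {F : H → PMB I X}

lemma lintegral_labelledIntensity_mul (q : PMB I X) {h : Aug I X → ℝ≥0∞} (hh : Measurable h) :
    ∫⁻ y, h y * q.labelledIntensity y = ∫⁻ x, h (0, x) * q.intensity x := by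
  have hm : Measurable fun y => h y * q.labelledIntensity y := hh.mul q.measurable_labelledIntensity
  rw [lintegral_aug hm, Fin.sum_univ_succ]
  simp [labelledIntensity]

lemma lintegral_labelledIntensity (q : PMB I X) :
    ∫⁻ y, q.labelledIntensity y = ∫⁻ x, q.intensity x := by
  simpa using q.lintegral_labelledIntensity_mul (h := 1) measurable_one

variable [MeasurableEq X]

lemma jointlyMeasurable_poissonFactor (hF : IsMeasurableFamily F) :
    JointlyMeasurable fun η => (F η).poissonFactor := by
  intro n
  refine Measurable.mul ?_ (jointlyMeasurable_prod_points (h := fun η (y : Aug I X) =>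
    if y.1 = 0 then (F η).intensity y.2 else 0) ?_ n)
  · have h1 : Measurable fun η => ∫⁻ x, (F η).intensity x := hF.intensity.lintegral_prod_right'
    exact (Real.measurable_exp.comp (h1.comp measurable_fst).ennreal_toReal.neg).ennreal_ofReal
  · refine Measurable.ite (measurable_snd (measurableSet_label 0)) ?_ measurable_const
    exact hF.intensity.comp (by fun_prop : Measurable fun p : H × Aug I X => (p.1, p.2.2))

variable [NullSingletonClass (volume : Measure X)]

lemma ofReal_exp_neg_mul_ofReal_exp (a : ℝ) :
    ENNReal.ofReal (Real.exp (-a)) * ENNReal.ofReal (Real.exp a) = 1 := by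
  rw [← ENNReal.ofReal_mul (Real.exp_pos _).le, ← Real.exp_add]
  simp

lemma isLabelledDensity_poissonFactor (q : PMB I X) :
    IsLabelledDensity 0 q.poissonFactor where
  measurable := (jointlyMeasurable_poissonFactor q.isMeasurableFamily_const).measurable ()
  eq_zero S hS := by
    by_contra h
    obtain ⟨y, hy, hy0⟩ := hS
    exact hy0 ((q.poissonFactor_ne_zero_iff S).1 h y hy).1
  integral_eq_one := by
    simp_rw [poissonFactor_eq]
    rw [lintegral_const_mul _ (measurable_prod_points q.measurable_labelledIntensity),
      lintegral_prod_points q.measurable_labelledIntensity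
        (by rw [lintegral_labelledIntensity]; exact q.intensity_finite),
      lintegral_labelledIntensity, ofReal_exp_neg_mul_ofReal_exp]

lemma lintegral_sum_points_mul_poissonFactor (q : PMB I X) {h : Aug I X → ℝ≥0∞}
    (hh : Measurable h) :
    ∫⁻ S, (∑ y ∈ S.points, h y) * q.poissonFactor S ∂setMeasure (Aug I X) =
      ∫⁻ x, h (0, x) * q.intensity x := by
  simp_rw [poissonFactor_eq]
  simp only [mul_left_comm (∑ y ∈ _, h y)]
  have hm : Measurable fun S : FinSet (Aug I X) =>
      (∑ y ∈ S.points, h y) * ∏ y ∈ S.points, q.labelledIntensity y :=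
    (measurable_sum_points hh).mul (measurable_prod_points q.measurable_labelledIntensity)
  rw [lintegral_const_mul _ hm, lintegral_sum_mul_prod_points q.measurable_labelledIntensity hh
    (by rw [lintegral_labelledIntensity]; exact q.intensity_finite),
    lintegral_labelledIntensity, lintegral_labelledIntensity_mul _ hh, mul_left_comm,
    ofReal_exp_neg_mul_ofReal_exp, mul_one]

variable {P : Measure H} [IsProbabilityMeasure P]

lemma isLabelledDensity_meanPoissonFactor (hF : IsMeasurableFamily F) :
    IsLabelledDensity 0 (meanPoissonFactor P F) :=
  isLabelledDensity_mixture (jointlyMeasurable_poissonFactor hF) fun η =>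
    (F η).isLabelledDensity_poissonFactor

lemma isLabelledDensity_meanBernoulliFactor (hF : IsMeasurableFamily F) (i : Fin I) :
    IsLabelledDensity i.succ (meanBernoulliFactor P F i) :=
  isLabelledDensity_mixture (jointlyMeasurable_bernoulliFactor hF i) fun η =>
    (F η).isLabelledDensity_bernoulliFactor i

/-- Campbell's formula for a mixture of Poisson densities. -/
lemma lintegral_sum_points_meanPoissonFactor (hF : IsMeasurableFamily F) {h : Aug I X → ℝ≥0∞}
    (hh : Measurable h) :
    ∫⁻ S, ∑ y ∈ S.points, h y ∂(setMeasure (Aug I X)).withDensity (meanPoissonFactor P F) =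
      ∫⁻ x, h (0, x) ∂(volume : Measure X).withDensity (meanIntensity P F) := by
  have hJ := jointlyMeasurable_poissonFactor hF
  have hh0 : Measurable fun x : X => h (0, x) := hh.comp (by fun_prop)
  rw [lintegral_withDensity_eq_lintegral_mul _ (isLabelledDensity_meanPoissonFactor hF).measurable
    (measurable_sum_points hh), lintegral_withDensity_eq_lintegral_mul _
    (measurable_meanIntensity hF) hh0]
  simp only [Pi.mul_apply, mul_comm (meanPoissonFactor P F _), mul_comm (meanIntensity P F _)]
  simp only [meanPoissonFactor, meanIntensity]
  rw [hJ.lintegral_mul_swap (measurable_sum_points hh)]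
  simp_rw [lintegral_sum_points_mul_poissonFactor _ hh]
  rw [lintegral_lintegral_swap]
  · exact lintegral_congr fun x => lintegral_const_mul _ (hF.intensity.comp measurable_prodMk_right)
  · exact ((hh0.comp measurable_snd).mul hF.intensity).aemeasurable

end Poisson

end PMB

namespace PMB

section PoissonProjection

variable {I : ℕ} {X H : Type*} [MeasureSpace X] [SigmaFinite (volume : Measure X)]
  [NullSingletonClass (volume : Measure X)] [MeasurableEq X] [MeasurableSpace H]
  {P : Measure H} [IsProbabilityMeasure P] {F : H → PMB I X}

lemma ae_forall_notMem_meanPoissonFactor (hF : IsMeasurableFamily F) {s : Set (Aug I X)}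
    (hs : MeasurableSet s)
    (h0 : ∀ᵐ x ∂(volume : Measure X).withDensity (meanIntensity P F), ((0 : Fin (I + 1)), x) ∉ s) :
    ∀ᵐ S ∂(setMeasure (Aug I X)).withDensity (meanPoissonFactor P F), ∀ y ∈ S.points, y ∉ s := by
  have hm : Measurable (s.indicator (1 : Aug I X → ℝ≥0∞)) := measurable_one.indicator hs
  have h1 := lintegral_sum_points_meanPoissonFactor (P := P) hF hm
  have hm0 : Measurable fun x : X => s.indicator (1 : Aug I X → ℝ≥0∞) (0, x) :=
    hm.comp measurable_prodMk_left
  rw [(lintegral_eq_zero_iff hm0).2,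
    lintegral_eq_zero_iff (measurable_sum_points hm)] at h1
  · filter_upwards [h1] with S hS y hy hys
    have := Finset.sum_eq_zero_iff.1 hS y hy
    simp [hys] at this
  · filter_upwards [h0] with x hx
    simp [hx]

/-- The points of a Poisson mixture have label `0` and avoid the null sets of the mean intensity. -/
lemma ae_forall_mem_meanPoissonFactor (hF : IsMeasurableFamily F) {Q : X → Prop}
    (hQ : ∀ᵐ x ∂(volume : Measure X).withDensity (meanIntensity P F), Q x) :
    ∀ᵐ S ∂(setMeasure (Aug I X)).withDensity (meanPoissonFactor P F),
      ∀ y ∈ S.points, y.1 = 0 ∧ Q y.2 := by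
  obtain ⟨t, ht, hm, h0⟩ := exists_measurable_superset_of_null (ae_iff.1 hQ)
  have h1 := ae_forall_notMem_meanPoissonFactor (P := P) hF (s := {y : Aug I X | y.1 = 0}ᶜ)
    (measurableSet_label 0).compl (by simp)
  have h2 := ae_forall_notMem_meanPoissonFactor (P := P) (I := I) hF (measurable_snd hm)
    (compl_mem_ae_iff.2 h0)
  filter_upwards [h1, h2] with S hS1 hS2 y hy
  refine ⟨by simpa using hS1 y hy, ?_⟩
  by_contra hn
  exact hS2 y hy (ht hn)

lemma ae_of_ae_forall_mem (hF : IsMeasurableFamily F) {Q : X → Prop}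
    (hQm : MeasurableSet {x | Q x})
    (h : ∀ᵐ S ∂(setMeasure (Aug I X)).withDensity (meanPoissonFactor P F),
      ∀ y ∈ S.points, Q y.2) :
    ∀ᵐ x ∂(volume : Measure X).withDensity (meanIntensity P F), Q x := by
  have hm : Measurable ({x | Q x}ᶜ.indicator (1 : X → ℝ≥0∞)) := measurable_one.indicator hQm.compl
  have h1 := lintegral_sum_points_meanPoissonFactor (P := P) (I := I) hF (hm.comp measurable_snd)
  rw [(lintegral_eq_zero_iff (measurable_sum_points (hm.comp measurable_snd))).2, eq_comm] at h1
  · simp only [Function.comp] at h1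
    rw [lintegral_eq_zero_iff hm] at h1
    filter_upwards [h1] with x hx
    by_contra hn
    simp [hn] at hx
  · filter_upwards [h] with S hS
    refine Finset.sum_eq_zero fun y hy => ?_
    simp [hS y hy]

lemma isProbabilityMeasure_meanPoissonFactor (hF : IsMeasurableFamily F) :
    IsProbabilityMeasure ((setMeasure (Aug I X)).withDensity (meanPoissonFactor P F)) := by
  constructor
  rw [withDensity_apply _ MeasurableSet.univ, Measure.restrict_univ]
  exact (isLabelledDensity_meanPoissonFactor hF).integral_eq_one

/-- Campbell's formula for real functions. -/
lemma integrable_sum_points (hF : IsMeasurableFamily F) {h : X → ℝ} (hh : Measurable h)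
    (hi : Integrable h ((volume : Measure X).withDensity (meanIntensity P F))) :
    Integrable (fun S : FinSet (Aug I X) => ∑ y ∈ S.points, h y.2)
        ((setMeasure (Aug I X)).withDensity (meanPoissonFactor P F)) ∧
      ∫ S, ∑ y ∈ S.points, h y.2 ∂(setMeasure (Aug I X)).withDensity (meanPoissonFactor P F) =
        ∫ x, h x ∂(volume : Measure X).withDensity (meanIntensity P F) := by
  set p := (setMeasure (Aug I X)).withDensity (meanPoissonFactor P F) with hp
  have part : ∀ k : X → ℝ, Measurable k →
      Integrable k ((volume : Measure X).withDensity (meanIntensity P F)) →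
      Integrable (fun S : FinSet (Aug I X) => (∑ y ∈ S.points, ENNReal.ofReal (k y.2)).toReal) p ∧
      ∫ S, (∑ y ∈ S.points, ENNReal.ofReal (k y.2)).toReal ∂p =
        (∫⁻ x, ENNReal.ofReal (k x)
          ∂(volume : Measure X).withDensity (meanIntensity P F)).toReal := by
    intro k hk hki
    have hm : Measurable fun y : Aug I X => ENNReal.ofReal (k y.2) := by fun_prop
    have h1 := lintegral_sum_points_meanPoissonFactor (P := P) hF hm
    have h2 : ∫⁻ S, ∑ y ∈ S.points, ENNReal.ofReal (k y.2) ∂p ≠ ∞ := by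
      rw [h1]; exact hki.lintegral_lt_top.ne
    refine ⟨integrable_toReal_of_lintegral_ne_top (measurable_sum_points hm).aemeasurable h2, ?_⟩
    rw [integral_toReal (measurable_sum_points hm).aemeasurable
      (ae_lt_top (measurable_sum_points hm) h2), h1]
  have e : ∀ S : FinSet (Aug I X), ∑ y ∈ S.points, h y.2 =
      (∑ y ∈ S.points, ENNReal.ofReal (h y.2)).toReal -
        (∑ y ∈ S.points, ENNReal.ofReal (-h y.2)).toReal := by
    intro S
    rw [ENNReal.toReal_sum (by simp), ENNReal.toReal_sum (by simp), ← Finset.sum_sub_distrib]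
    refine Finset.sum_congr rfl fun y _ => ?_
    rcases le_total 0 (h y.2) with h0 | h0
    · simp [h0, ENNReal.ofReal_of_nonpos]
    · simp [h0, ENNReal.ofReal_of_nonpos]
  obtain ⟨i1, v1⟩ := part h hh hi
  obtain ⟨i2, v2⟩ := part (fun x => -h x) hh.neg hi.neg
  simp_rw [e]
  refine ⟨i1.sub i2, ?_⟩
  rw [integral_sub i1 i2, v1, v2, integral_eq_lintegral_pos_part_sub_lintegral_neg_part hi]

variable (q : PMB I X)

/-- If the divergence of some Poisson density is finite, then the mean intensity is integrable. -/
lemma lintegral_meanIntensity_ne_top (hF : IsMeasurableFamily F)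
    (hfin : setKLD (meanPoissonFactor P F) q.poissonFactor ≠ ∞) :
    ∫⁻ x, meanIntensity P F x ≠ ∞ := by
  have := isProbabilityMeasure_meanPoissonFactor (P := P) hF
  have hf := isLabelledDensity_meanPoissonFactor (P := P) hF
  have hq := q.isLabelledDensity_poissonFactor
  let q' : PMB I X := { q with
    intensity := fun x => ENNReal.ofReal (Real.exp 1) * q.intensity x
    measurable_intensity := q.measurable_intensity.const_mul _
    intensity_finite := by
      rw [lintegral_const_mul _ q.measurable_intensity]
      exact ENNReal.mul_ne_top ENNReal.ofReal_ne_top q.intensity_finite }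
  have hq' := q'.isLabelledDensity_poissonFactor
  have top : ∀ {h : FinSet (Aug I X) → ℝ≥0∞}, ∫⁻ S, h S ∂setMeasure (Aug I X) = 1 →
      ∫⁻ S, h S ∂setMeasure (Aug I X) ≠ ∞ := fun h => by rw [h]; exact ENNReal.one_ne_top
  have hg0 := ((klDiv_withDensity_ne_top_iff hf.measurable hq.measurable
    (top hf.integral_eq_one) (top hq.integral_eq_one)).1 hfin).1
  set p := (setMeasure (Aug I X)).withDensity (meanPoissonFactor P F) with hp
  have hlt := ae_forall_mem_meanPoissonFactor (P := P) (I := I) hF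
    (ae_withDensity_lt_top (f := meanIntensity P F) q.measurable_intensity q.intensity_finite)
  have hgood : ∀ᵐ S ∂p, ∀ y ∈ S.points, y.1 = 0 ∧ q.intensity y.2 ≠ 0 ∧ q.intensity y.2 < ∞ := by
    filter_upwards [hg0, hlt] with S h1 h2 y hy
    exact ⟨(h2 y hy).1, ((poissonFactor_ne_zero_iff q S).1 h1 y hy).2, (h2 y hy).2⟩
  have hexp : ENNReal.ofReal (Real.exp 1) ≠ 0 := by simp [Real.exp_pos]
  have hgood' : ∀ᵐ S ∂p, ∀ y ∈ S.points,
      y.1 = 0 ∧ q'.intensity y.2 ≠ 0 ∧ q'.intensity y.2 < ∞ := by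
    filter_upwards [hgood] with S h y hy
    exact ⟨(h y hy).1, mul_ne_zero hexp (h y hy).2.1,
      ENNReal.mul_lt_top ENNReal.ofReal_lt_top (h y hy).2.2⟩
  have hr0 : ∀ᵐ S ∂p, q'.poissonFactor S ≠ 0 := by
    filter_upwards [hgood'] with S h
    exact (poissonFactor_ne_zero_iff q' S).2 fun y hy => ⟨(h y hy).1, (h y hy).2.1⟩
  have hpos := lintegral_ofReal_logRatio_lt_top hf.measurable hq.measurable hq'.measurable
    (top hf.integral_eq_one) (top hq.integral_eq_one) (top hq'.integral_eq_one) hr0 hfin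
  have h1 := lintegral_sum_points_meanPoissonFactor (P := P) (I := I) hF measurable_one
  simp only [Pi.one_apply, lintegral_one] at h1
  rw [withDensity_apply _ MeasurableSet.univ, Measure.restrict_univ] at h1
  rw [← h1]
  refine ne_of_lt ?_
  calc ∫⁻ S, ∑ y ∈ S.points, 1 ∂p
      ≤ ∫⁻ S, (ENNReal.ofReal (logRatio q'.poissonFactor q.poissonFactor S) +
          ENNReal.ofReal ((∫⁻ x, q'.intensity x).toReal - (∫⁻ x, q.intensity x).toReal)) ∂p := by
        refine lintegral_mono_ae ?_
        filter_upwards [hgood, hgood'] with S h2 h3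
        refine le_trans ?_ ENNReal.ofReal_add_le
        have h4 : ∑ y ∈ S.points, Real.log (q'.intensity y.2).toReal =
            ∑ y ∈ S.points, (1 + Real.log (q.intensity y.2).toReal) := by
          refine Finset.sum_congr rfl fun y hy => ?_
          rw [ENNReal.toReal_mul, ENNReal.toReal_ofReal (Real.exp_pos _).le,
            Real.log_mul (Real.exp_pos _).ne'
              (ENNReal.toReal_pos (h2 y hy).2.1 (h2 y hy).2.2.ne).ne', Real.log_exp]
        rw [logRatio, log_poissonFactor q S h2, log_poissonFactor q' S h3, h4,
          Finset.sum_add_distrib]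
        have h5 : ∑ y ∈ S.points, (1 : ℝ≥0∞) = ENNReal.ofReal (∑ y ∈ S.points, (1 : ℝ)) := by
          simp
        rw [h5]
        exact ENNReal.ofReal_le_ofReal (by linarith)
    _ < ∞ := by
        rw [lintegral_add_right _ measurable_const]
        refine ENNReal.add_lt_top.2 ⟨hpos, ?_⟩
        simp

/-- The divergence of a Poisson density from a mixture of Poisson densities splits into the
divergence of the Poisson density with the mean intensity and the divergence of the intensities. -/
lemma setKLD_poissonFactor_eq_add (hF : IsMeasurableFamily F) (m : PMB I X)
    (hm : m.intensity =ᵐ[volume] meanIntensity P F) :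
    setKLD (meanPoissonFactor P F) q.poissonFactor =
      setKLD (meanPoissonFactor P F) m.poissonFactor +
        klDiv ((volume : Measure X).withDensity (meanIntensity P F))
          ((volume : Measure X).withDensity q.intensity) := by
  have := isProbabilityMeasure_meanPoissonFactor (P := P) hF
  have hf := isLabelledDensity_meanPoissonFactor (P := P) hF
  have hq := q.isLabelledDensity_poissonFactor
  have hm1 := m.isLabelledDensity_poissonFactor
  have top : ∀ {h : FinSet (Aug I X) → ℝ≥0∞}, ∫⁻ S, h S ∂setMeasure (Aug I X) = 1 →
      ∫⁻ S, h S ∂setMeasure (Aug I X) ≠ ∞ := fun h => by rw [h]; exact ENNReal.one_ne_top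
  have hlm : Measurable (meanIntensity P F) := measurable_meanIntensity hF
  have hlint : ∫⁻ x, m.intensity x = ∫⁻ x, meanIntensity P F x := lintegral_congr_ae hm
  have hli : ∫⁻ x, meanIntensity P F x ≠ ∞ := hlint ▸ m.intensity_finite
  set p := (setMeasure (Aug I X)).withDensity (meanPoissonFactor P F) with hp
  set κ := (volume : Measure X).withDensity (meanIntensity P F) with hκ
  set h := logRatio (meanIntensity P F) q.intensity with hh
  have hhm : Measurable h := measurable_logRatio hlm q.measurable_intensity
  have hiff := klDiv_withDensity_ne_top_iff hlm q.measurable_intensity hli q.intensity_finite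
  have hκm : ∀ᵐ x ∂κ, m.intensity x = meanIntensity P F x ∧ m.intensity x ≠ 0 ∧
      m.intensity x < ∞ := by
    filter_upwards [(withDensity_absolutelyContinuous _ _).ae_le hm,
      ae_withDensity_ne_zero hlm, ae_withDensity_lt_top hlm hli] with x h1 h2 h3
    rw [h1]
    exact ⟨rfl, h2, h3⟩
  have hmgood := ae_forall_mem_meanPoissonFactor (P := P) (I := I) hF hκm
  have hr0 : ∀ᵐ S ∂p, m.poissonFactor S ≠ 0 := by
    filter_upwards [hmgood] with S hS
    exact (poissonFactor_ne_zero_iff m S).2 fun y hy => ⟨(hS y hy).1, (hS y hy).2.2.1⟩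
  have hqlt := ae_forall_mem_meanPoissonFactor (P := P) (I := I) hF
    (ae_withDensity_lt_top (f := meanIntensity P F) q.measurable_intensity q.intensity_finite)
  set c : ℝ := (∫⁻ x, q.intensity x).toReal - (∫⁻ x, meanIntensity P F x).toReal with hc
  have hlog : (∀ᵐ x ∂κ, q.intensity x ≠ 0) → logRatio m.poissonFactor q.poissonFactor =ᵐ[p]
      fun S => c + ∑ y ∈ S.points, h y.2 := by
    intro h0
    filter_upwards [hmgood, hqlt, ae_forall_mem_meanPoissonFactor hF h0] with S h1 h2 h3
    rw [logRatio, log_poissonFactor m S fun y hy => ⟨(h1 y hy).1, (h1 y hy).2.2⟩,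
      log_poissonFactor q S fun y hy => ⟨(h1 y hy).1, (h3 y hy).2, (h2 y hy).2⟩, hlint]
    have h4 : ∑ y ∈ S.points, h y.2 = ∑ y ∈ S.points, Real.log (m.intensity y.2).toReal -
        ∑ y ∈ S.points, Real.log (q.intensity y.2).toReal := by
      rw [← Finset.sum_sub_distrib]
      exact Finset.sum_congr rfl fun y hy => by rw [(h1 y hy).2.1]; rfl
    rw [h4]
    ring
  by_cases hfin : klDiv κ ((volume : Measure X).withDensity q.intensity) ≠ ∞
  · obtain ⟨h0, hi⟩ := hiff.1 hfin
    obtain ⟨hsi, hsv⟩ := integrable_sum_points (P := P) (I := I) hF hhm hi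
    have hci : Integrable (fun S : FinSet (Aug I X) => c + ∑ y ∈ S.points, h y.2) p :=
      (integrable_const c).add hsi
    refine klDiv_withDensity_eq_add hf.measurable hq.measurable hm1.measurable
      (top hf.integral_eq_one) (top hq.integral_eq_one) (top hm1.integral_eq_one) hr0 ?_
      ((integrable_congr (hlog h0)).2 hci) hfin ?_
    · filter_upwards [ae_forall_mem_meanPoissonFactor hF h0] with S hS
      exact (poissonFactor_ne_zero_iff q S).2 hS
    · rw [toReal_klDiv_withDensity hlm q.measurable_intensity hli q.intensity_finite h0 hi,
        integral_congr_ae (hlog h0), integral_add (integrable_const c) hsi, hsv,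
        hq.integral_eq_one, hm1.integral_eq_one]
      simp [hc]
      ring
  · push Not at hfin
    rw [hfin, add_top]
    by_contra hne
    refine hiff.2 ?_ hfin
    have hg0 := ((klDiv_withDensity_ne_top_iff hf.measurable hq.measurable
      (top hf.integral_eq_one) (top hq.integral_eq_one)).1 hne).1
    have h0 : ∀ᵐ x ∂κ, q.intensity x ≠ 0 := by
      refine ae_of_ae_forall_mem (I := I) hF
        (q.measurable_intensity (measurableSet_singleton 0)).compl ?_
      filter_upwards [hg0] with S hS y hy using ((poissonFactor_ne_zero_iff q S).1 hS y hy).2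
    refine ⟨h0, ?_⟩
    have hneg : ∫⁻ x, ENNReal.ofReal (-h x) ∂κ < ∞ :=
      lintegral_ofReal_neg_logRatio_lt_top hlm q.measurable_intensity hli q.intensity_finite h0
    have hpos := lintegral_ofReal_logRatio_lt_top hf.measurable hq.measurable hm1.measurable
      (top hf.integral_eq_one) (top hq.integral_eq_one) (top hm1.integral_eq_one) hr0 hne
    refine integrable_of_lintegral_ofReal hhm ?_ hneg
    have mp : Measurable fun y : Aug I X => ENNReal.ofReal (h y.2) := by fun_prop
    have mn : Measurable fun y : Aug I X => ENNReal.ofReal (-h y.2) := by fun_prop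
    have c1 := lintegral_sum_points_meanPoissonFactor (P := P) hF mp
    have c2 := lintegral_sum_points_meanPoissonFactor (P := P) hF mn
    simp only at c1 c2
    rw [← c1]
    calc ∫⁻ S, ∑ y ∈ S.points, ENNReal.ofReal (h y.2) ∂p
        ≤ ∫⁻ S, (ENNReal.ofReal (logRatio m.poissonFactor q.poissonFactor S) +
            (ENNReal.ofReal (-c) + ∑ y ∈ S.points, ENNReal.ofReal (-h y.2))) ∂p := by
          refine lintegral_mono_ae ?_
          filter_upwards [hlog h0] with S hS
          have e : ∀ k : X → ℝ, ∑ y ∈ S.points, ENNReal.ofReal (k y.2) =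
              ENNReal.ofReal (∑ y ∈ S.points, max (k y.2) 0) := by
            intro k
            rw [ENNReal.ofReal_sum_of_nonneg fun y _ => le_max_right _ _]
            exact Finset.sum_congr rfl fun y _ => by simp [ENNReal.ofReal_max]
          rw [e h, e fun x => -h x]
          have e2 : ∑ y ∈ S.points, max (h y.2) 0 =
              logRatio m.poissonFactor q.poissonFactor S +
                (-c + ∑ y ∈ S.points, max (-h y.2) 0) := by
            have : ∑ y ∈ S.points, max (h y.2) 0 =
                ∑ y ∈ S.points, (h y.2 + max (-h y.2) 0) := by
              refine Finset.sum_congr rfl fun y _ => ?_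
              rcases le_total 0 (h y.2) with h0 | h0
              · simp [h0]
              · simp [h0]
            rw [this, Finset.sum_add_distrib, hS]
            ring
          rw [e2]
          exact ENNReal.ofReal_add_le.trans (add_le_add_right ENNReal.ofReal_add_le _)
      _ < ∞ := by
          rw [lintegral_add_left
            (measurable_logRatio hm1.measurable hq.measurable).ennreal_ofReal,
            lintegral_add_left measurable_const, c2]
          refine ENNReal.add_lt_top.2 ⟨hpos, ENNReal.add_lt_top.2 ⟨by simp, hneg⟩⟩

end PoissonProjection

end PMB

lemma IsLabelledDensity.lintegral_ne_top {I : ℕ} {X : Type*} [MeasureSpace X] {u : Fin (I + 1)}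
    {g : FinSet (Aug I X) → ℝ≥0∞} (hg : IsLabelledDensity u g) :
    ∫⁻ S, g S ∂setMeasure (Aug I X) ≠ ∞ := by
  rw [hg.integral_eq_one]; exact ENNReal.one_ne_top

lemma IsLabelledDensity.setKLD_eq_zero_iff {I : ℕ} {X : Type*} [MeasureSpace X] {u : Fin (I + 1)}
    {f g : FinSet (Aug I X) → ℝ≥0∞} (hf : IsLabelledDensity u f) (hg : IsLabelledDensity u g) :
    setKLD f g = 0 ↔ g =ᵐ[setMeasure (Aug I X)] f := by
  rw [RFS.setKLD_eq_zero_iff hf.measurable hg.measurable hf.lintegral_ne_top hg.lintegral_ne_top]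
  exact Filter.eventuallyEq_comm

lemma isLabelledDensity_cons {I : ℕ} {X : Type*} [MeasureSpace X] {gU : FinSet (Aug I X) → ℝ≥0∞}
    {g : Fin I → FinSet (Aug I X) → ℝ≥0∞} (hgU : IsLabelledDensity 0 gU)
    (hg : ∀ i : Fin I, IsLabelledDensity i.succ (g i)) (u : Fin (I + 1)) :
    IsLabelledDensity u ((Fin.cons gU g : Fin (I + 1) → FinSet (Aug I X) → ℝ≥0∞) u) := by
  refine Fin.cases ?_ (fun i => ?_) u
  · exact hgU
  · exact hg i

namespace PMB

/-- The defining equation of the merged spatial densities, without division. -/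
lemma isMerged_spatial_iff {I : ℕ} {X H : Type*} [MeasureSpace X] [MeasurableSpace H]
    {P : Measure H} {F : H → PMB I X} (q : PMB I X) (i : Fin I)
    (hr : q.existProb i = ∫⁻ η, (F η).existProb i ∂P) {x : X} (h0 : q.existProb i ≠ 0) :
    q.spatial i x = (∫⁻ η, (F η).existProb i * (F η).spatial i x ∂P) /
        ∫⁻ η, (F η).existProb i ∂P ↔
      q.existProb i * q.spatial i x = ∫⁻ η, (F η).existProb i * (F η).spatial i x ∂P := by
  have ht : q.existProb i ≠ ∞ := ne_top_of_le_ne_top ENNReal.one_ne_top (q.existProb_le_one i)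
  rw [← hr, ENNReal.eq_div_iff h0 ht]

variable {I : ℕ} {X H : Type*} [MeasureSpace X] [MeasurableSpace H]
  {P : Measure H} [IsProbabilityMeasure P] {F : H → PMB I X}

lemma lintegral_existProb_le_one (i : Fin I) : ∫⁻ η, (F η).existProb i ∂P ≤ 1 :=
  (lintegral_mono fun η => (F η).existProb_le_one i).trans (by simp)

lemma meanBernoulliFactor_toSet_zero (hF : IsMeasurableFamily F) (i : Fin I)
    (x : Fin 0 → Aug I X) :
    meanBernoulliFactor P F i (toSet x) = 1 - ∫⁻ η, (F η).existProb i ∂P := by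
  simp_rw [meanBernoulliFactor, bernoulliFactor_toSet_zero]
  rw [lintegral_sub (hF.existProb i)
    (ne_top_of_le_ne_top ENNReal.one_ne_top (lintegral_existProb_le_one i))
    (Filter.Eventually.of_forall fun η => (F η).existProb_le_one i)]
  simp

lemma meanBernoulliFactor_toSet_one (i : Fin I) (x : Fin 1 → Aug I X) :
    meanBernoulliFactor P F i (toSet x) =
      if (x 0).1 = i.succ then ∫⁻ η, (F η).existProb i * (F η).spatial i (x 0).2 ∂P else 0 := by
  simp_rw [meanBernoulliFactor, bernoulliFactor_toSet_one]
  split_ifs <;> simp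

lemma measurable_existProb_mul_spatial (hF : IsMeasurableFamily F) (i : Fin I) :
    Measurable fun p : H × X => (F p.1).existProb i * (F p.1).spatial i p.2 :=
  ((hF.existProb i).comp measurable_fst).mul (hF.spatial i)

/-- The mixture of conditional spatial densities, weighted by the existence probabilities, has the
mean existence probability as its mass. -/
lemma lintegral_lintegral_existProb_mul_spatial [SigmaFinite (volume : Measure X)]
    (hF : IsMeasurableFamily F) (i : Fin I) :
    ∫⁻ x, ∫⁻ η, (F η).existProb i * (F η).spatial i x ∂P = ∫⁻ η, (F η).existProb i ∂P := by
  rw [lintegral_lintegral_swap (f := fun x η => (F η).existProb i * (F η).spatial i x)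
    ((measurable_existProb_mul_spatial hF i).comp measurable_swap).aemeasurable]
  refine lintegral_congr fun η => ?_
  rw [lintegral_const_mul _ ((F η).measurable_spatial i), (F η).spatial_integral i, mul_one]

lemma ae_existProb_mul_spatial_eq {P : Measure H} (hF : IsMeasurableFamily F) {q : PMB I X}
    (hq : IsMerged P F q) (i : Fin I) :
    ∀ᵐ x, q.existProb i * q.spatial i x = ∫⁻ η, (F η).existProb i * (F η).spatial i x ∂P := by
  by_cases h0 : q.existProb i = 0
  · refine Filter.Eventually.of_forall fun x => ?_
    have h1 := hq.existProb i
    rw [h0, eq_comm, lintegral_eq_zero_iff (hF.existProb i)] at h1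
    have hm : Measurable fun η => (F η).existProb i * (F η).spatial i x :=
      (measurable_existProb_mul_spatial hF i).comp measurable_prodMk_right
    rw [h0, zero_mul, eq_comm, lintegral_eq_zero_iff hm]
    filter_upwards [h1] with η hη
    simp [hη]
  · filter_upwards [hq.spatial i h0] with x hx
    exact (isMerged_spatial_iff q i (hq.existProb i) h0).1 hx

/-- A PMB with the merged parameters exists, if the mean intensity is integrable. -/
lemma exists_isMerged [SigmaFinite (volume : Measure X)] (hF : IsMeasurableFamily F)
    (h : ∫⁻ x, ∫⁻ η, (F η).intensity x ∂P ≠ ∞) : ∃ q, IsMerged P F q := by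
  classical
  obtain ⟨η₀⟩ : Nonempty H := P.nonempty_of_neZero
  have hsm : ∀ i, Measurable fun x => ∫⁻ η, (F η).existProb i * (F η).spatial i x ∂P := fun i =>
    (measurable_existProb_mul_spatial hF i).lintegral_prod_left'
  refine ⟨{
    intensity := fun x => ∫⁻ η, (F η).intensity x ∂P
    existProb := fun i => ∫⁻ η, (F η).existProb i ∂P
    spatial := fun i x => if ∫⁻ η, (F η).existProb i ∂P = 0 then (F η₀).spatial i x else
      (∫⁻ η, (F η).existProb i * (F η).spatial i x ∂P) / ∫⁻ η, (F η).existProb i ∂P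
    measurable_intensity := measurable_meanIntensity hF
    intensity_finite := h
    existProb_le_one := lintegral_existProb_le_one
    measurable_spatial := fun i => Measurable.ite (by simp) ((F η₀).measurable_spatial i)
      ((hsm i).div_const _)
    spatial_integral := fun i => ?_ }, ?_, fun i => rfl, fun i hi => ?_⟩
  · by_cases h0 : ∫⁻ η, (F η).existProb i ∂P = 0
    · simp only [h0, if_true]
      exact (F η₀).spatial_integral i
    · simp only [h0, if_false, div_eq_mul_inv]
      rw [lintegral_mul_const _ (hsm i), lintegral_lintegral_existProb_mul_spatial hF i,
        ENNReal.mul_inv_cancel h0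
          (ne_top_of_le_ne_top ENNReal.one_ne_top (lintegral_existProb_le_one i))]
  · exact Filter.EventuallyEq.rfl
  · exact Filter.Eventually.of_forall fun x => if_neg hi

variable [SigmaFinite (volume : Measure X)]

/-- A PMB with the averaged factors has the merged parameters. -/
lemma isMerged_of_ae_eq (hF : IsMeasurableFamily F) {q : PMB I X}
    (hU : q.intensity =ᵐ[volume] meanIntensity P F)
    (hB : ∀ i, q.bernoulliFactor i =ᵐ[setMeasure _] meanBernoulliFactor P F i) :
    IsMerged P F q := by
  have hr : ∀ i, q.existProb i = ∫⁻ η, (F η).existProb i ∂P := by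
    intro i
    have h0 := ae_toSet_of_ae_setMeasure (hB i) 0
    rw [Measure.pi_of_empty (fun _ => (volume : Measure (Aug I X))) Fin.elim0] at h0
    obtain ⟨x, hx⟩ := h0.exists
    rw [bernoulliFactor_toSet_zero, meanBernoulliFactor_toSet_zero hF] at hx
    exact (ENNReal.sub_right_inj ENNReal.one_ne_top (q.existProb_le_one i)
      (lintegral_existProb_le_one i)).1 hx
  refine ⟨hU, hr, fun i hi => ?_⟩
  have h1 := (measurePreserving_funUnique (volume : Measure (Aug I X)) (Fin 1)).symm
    |>.quasiMeasurePreserving.ae (ae_toSet_of_ae_setMeasure (hB i) 1)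
  rw [volume_aug] at h1
  have h2 := Measure.ae_ae_of_ae_prod h1
  rw [Measure.ae_count_iff] at h2
  filter_upwards [h2 i.succ] with x hx
  refine (isMerged_spatial_iff q i (hr i) hi).2 ?_
  simpa [bernoulliFactor_toSet_one, meanBernoulliFactor_toSet_one] using hx

variable [MeasurableEq X]

/-- The Poisson and Bernoulli factors of a PMB, indexed by the label. -/
noncomputable def factors (q : PMB I X) : Fin (I + 1) → FinSet (Aug I X) → ℝ≥0∞ :=
  Fin.cons q.poissonFactor q.bernoulliFactor

lemma jointlyMeasurable_factors (hF : IsMeasurableFamily F) (u : Fin (I + 1)) :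
    JointlyMeasurable fun η => (F η).factors u := by
  refine Fin.cases ?_ (fun i => ?_) u
  · exact jointlyMeasurable_poissonFactor hF
  · exact jointlyMeasurable_bernoulliFactor hF i

variable [NullSingletonClass (volume : Measure X)]

/-- The Bernoulli factors of a PMB with the merged parameters are the averaged factors. -/
lemma bernoulliFactor_ae_eq_of_isMerged (hF : IsMeasurableFamily F) {q : PMB I X}
    (hq : IsMerged P F q) (i : Fin I) :
    q.bernoulliFactor i =ᵐ[setMeasure _] meanBernoulliFactor P F i := by
  refine ae_setMeasure (measurableSet_eq_fun (q.isLabelledDensity_bernoulliFactor i).measurable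
    (isLabelledDensity_meanBernoulliFactor hF i).measurable) fun n => ?_
  match n with
  | 0 =>
    refine Filter.Eventually.of_forall fun x => ?_
    rw [bernoulliFactor_toSet_zero, meanBernoulliFactor_toSet_zero hF, hq.existProb i]
  | 1 =>
    have h1 := Measure.tendsto_eval_ae_ae (μ := fun _ : Fin 1 => (volume : Measure (Aug I X)))
      (i := 0) |>.eventually (ae_aug_of_ae (ae_existProb_mul_spatial_eq hF hq i))
    filter_upwards [h1] with x hx
    rw [bernoulliFactor_toSet_one, meanBernoulliFactor_toSet_one, hx]
  | n + 2 =>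
    filter_upwards [ae_injective (n + 2)] with x hx
    simp [meanBernoulliFactor, bernoulliFactor_toSet_of_injective _ i (by omega) hx]

lemma isLabelledDensity_factors (q : PMB I X) (u : Fin (I + 1)) :
    IsLabelledDensity u (q.factors u) :=
  isLabelledDensity_cons q.isLabelledDensity_poissonFactor q.isLabelledDensity_bernoulliFactor u

/-- The divergence of a product density from a mixture of PMBs splits into the divergence of the
product of the averaged factors and the divergences of the factors. -/
lemma setKLD_productDensity_eq_add (hF : IsMeasurableFamily F) {gU : FinSet (Aug I X) → ℝ≥0∞}
    {g : Fin I → FinSet (Aug I X) → ℝ≥0∞} (hgU : IsLabelledDensity 0 gU)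
    (hg : ∀ i : Fin I, IsLabelledDensity i.succ (g i)) :
    setKLD (meanDensity P F) (productDensity gU g) =
      setKLD (meanDensity P F)
          (productDensity (meanPoissonFactor P F) (meanBernoulliFactor P F)) +
        (setKLD (meanPoissonFactor P F) gU + ∑ i, setKLD (meanBernoulliFactor P F i) (g i)) := by
  have hJ := jointlyMeasurable_factors hF
  have hG : ∀ u η, IsLabelledDensity u ((F η).factors u) := fun u η =>
    (F η).isLabelledDensity_factors u
  have hd : meanDensity P F = mixture P fun η => labelProduct fun u => (F η).factors u := by
    ext S
    simp only [meanDensity, density, productDensity_eq_labelProduct]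
    rfl
  have hmix : (fun u => mixture P fun η => (F η).factors u) =
      Fin.cons (meanPoissonFactor P F) (meanBernoulliFactor P F) := by
    ext u S
    refine Fin.cases ?_ (fun i => ?_) u <;> rfl
  rw [hd, productDensity_eq_labelProduct, productDensity_eq_labelProduct, ← hmix,
    setKLD_labelProduct_eq_add (jointlyMeasurable_labelProduct hJ).measurable_mixture
      (lintegral_mixture_labelProduct hJ hG)
      (fun u => isLabelledDensity_mixture (hJ u) (hG u)) (isLabelledDensity_cons hgU hg)
      (map_slice_withDensity_mixture hJ hG), Fin.sum_univ_succ]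
  rfl

lemma setKLD_density_eq_add (hF : IsMeasurableFamily F) (q : PMB I X) :
    setKLD (meanDensity P F) q.density =
      setKLD (meanDensity P F)
          (productDensity (meanPoissonFactor P F) (meanBernoulliFactor P F)) +
        (setKLD (meanPoissonFactor P F) q.poissonFactor +
          ∑ i, setKLD (meanBernoulliFactor P F i) (q.bernoulliFactor i)) :=
  setKLD_productDensity_eq_add hF q.isLabelledDensity_poissonFactor
    q.isLabelledDensity_bernoulliFactor

lemma setKLD_density_of_isMerged (hF : IsMeasurableFamily F) {q : PMB I X}
    (hq : IsMerged P F q) :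
    setKLD (meanDensity P F) q.density =
      setKLD (meanDensity P F)
          (productDensity (meanPoissonFactor P F) (meanBernoulliFactor P F)) +
        setKLD (meanPoissonFactor P F) q.poissonFactor := by
  rw [setKLD_density_eq_add hF, Finset.sum_eq_zero, add_zero]
  intro i _
  rw [(isLabelledDensity_meanBernoulliFactor hF i).setKLD_eq_zero_iff
    (q.isLabelledDensity_bernoulliFactor i)]
  exact bernoulliFactor_ae_eq_of_isMerged hF hq i

lemma setKLD_poissonFactor_le_of_isMerged (hF : IsMeasurableFamily F) {q : PMB I X}
    (hq : IsMerged P F q) (q' : PMB I X) :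
    setKLD (meanPoissonFactor P F) q.poissonFactor ≤
      setKLD (meanPoissonFactor P F) q'.poissonFactor := by
  rw [setKLD_poissonFactor_eq_add q' hF q hq.intensity]
  exact le_self_add

lemma setKLD_density_le_of_isMerged (hF : IsMeasurableFamily F) {q : PMB I X}
    (hq : IsMerged P F q) (q' : PMB I X) :
    setKLD (meanDensity P F) q.density ≤ setKLD (meanDensity P F) q'.density := by
  rw [setKLD_density_of_isMerged hF hq, setKLD_density_eq_add hF q']
  exact add_le_add_right
    ((setKLD_poissonFactor_le_of_isMerged hF hq q').trans le_self_add) _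

/-- A minimiser of the divergence among product densities has the averaged factors. -/
lemma ae_eq_of_setKLD_productDensity_le (hF : IsMeasurableFamily F)
    {gU : FinSet (Aug I X) → ℝ≥0∞} {g : Fin I → FinSet (Aug I X) → ℝ≥0∞}
    (hgU : IsLabelledDensity 0 gU) (hg : ∀ i : Fin I, IsLabelledDensity i.succ (g i))
    (hfin : setKLD (meanDensity P F) (productDensity gU g) ≠ ∞)
    (hle : setKLD (meanDensity P F) (productDensity gU g) ≤ setKLD (meanDensity P F)
      (productDensity (meanPoissonFactor P F) (meanBernoulliFactor P F))) :
    gU =ᵐ[setMeasure _] meanPoissonFactor P F ∧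
      ∀ i, g i =ᵐ[setMeasure _] meanBernoulliFactor P F i := by
  rw [setKLD_productDensity_eq_add hF hgU hg] at hfin hle
  have h0 := (ENNReal.add_le_add_iff_left (ENNReal.add_ne_top.1 hfin).1).1
    (hle.trans_eq (add_zero _).symm)
  rw [nonpos_iff_eq_zero, add_eq_zero, Finset.sum_eq_zero_iff] at h0
  exact ⟨((isLabelledDensity_meanPoissonFactor hF).setKLD_eq_zero_iff hgU).1 h0.1, fun i =>
    ((isLabelledDensity_meanBernoulliFactor hF i).setKLD_eq_zero_iff (hg i)).1
      (h0.2 i (Finset.mem_univ i))⟩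

/-- A minimiser of the divergence among PMB densities has the merged parameters. -/
lemma isMerged_of_setKLD_density_le (hF : IsMeasurableFamily F) {q : PMB I X}
    (hfin : setKLD (meanDensity P F) q.density ≠ ∞)
    (hle : ∀ q' : PMB I X,
      setKLD (meanDensity P F) q.density ≤ setKLD (meanDensity P F) q'.density) :
    IsMerged P F q := by
  have hsplit := setKLD_density_eq_add (P := P) hF q
  rw [hsplit] at hfin
  obtain ⟨hR, hfin'⟩ := ENNReal.add_ne_top.1 hfin
  obtain ⟨hpois, -⟩ := ENNReal.add_ne_top.1 hfin'
  have hli : ∫⁻ x, meanIntensity P F x ≠ ∞ := lintegral_meanIntensity_ne_top q hF hpois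
  obtain ⟨m, hm⟩ := exists_isMerged (P := P) hF hli
  have h1 := hle m
  have hpyth := setKLD_poissonFactor_eq_add (P := P) q hF m hm.intensity
  rw [hpyth] at hpois
  obtain ⟨hmp, -⟩ := ENNReal.add_ne_top.1 hpois
  rw [hsplit, setKLD_density_of_isMerged hF hm, hpyth, ENNReal.add_le_add_iff_left hR,
    add_assoc] at h1
  have h2 := (ENNReal.add_le_add_iff_left hmp).1 (h1.trans_eq (add_zero _).symm)
  rw [nonpos_iff_eq_zero, add_eq_zero, Finset.sum_eq_zero_iff] at h2
  have : IsFiniteMeasure ((volume : Measure X).withDensity (meanIntensity P F)) :=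
    isFiniteMeasure_withDensity hli
  have : IsFiniteMeasure ((volume : Measure X).withDensity q.intensity) :=
    isFiniteMeasure_withDensity q.intensity_finite
  refine isMerged_of_ae_eq hF ?_ fun i => ?_
  · have h3 := h2.1
    rw [klDiv_eq_zero_iff, withDensity_eq_iff (measurable_meanIntensity hF).aemeasurable
      q.measurable_intensity.aemeasurable hli] at h3
    exact h3.symm
  · exact ((isLabelledDensity_meanBernoulliFactor hF i).setKLD_eq_zero_iff
      (q.isLabelledDensity_bernoulliFactor i)).1 (h2.2 i (Finset.mem_univ i))

/-- If the conditional intensity does not depend on the nuisance variable, then the averaged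
Poisson factor is a Poisson factor. -/
lemma poissonFactor_ae_eq_meanPoissonFactor (hF : IsMeasurableFamily F) {q : PMB I X}
    (h : ∀ᵐ η ∂P, (F η).intensity =ᵐ[volume] q.intensity) :
    q.poissonFactor =ᵐ[setMeasure _] meanPoissonFactor P F := by
  have hq := q.isLabelledDensity_poissonFactor
  have hf := isLabelledDensity_meanPoissonFactor (P := P) hF
  rw [← withDensity_eq_iff hq.measurable.aemeasurable hf.measurable.aemeasurable
    hq.lintegral_ne_top]
  ext s hs
  have hw : Measurable (s.indicator (1 : FinSet (Aug I X) → ℝ≥0∞)) := measurable_one.indicator hs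
  have e : ∀ k : FinSet (Aug I X) → ℝ≥0∞, ∫⁻ S in s, k S ∂setMeasure (Aug I X) =
      ∫⁻ S, s.indicator 1 S * k S ∂setMeasure (Aug I X) := by
    intro k
    rw [← lintegral_indicator hs]
    refine lintegral_congr fun S => ?_
    by_cases hS : S ∈ s <;> simp [hS]
  rw [withDensity_apply _ hs, withDensity_apply _ hs, e, e]
  simp only [meanPoissonFactor]
  rw [(jointlyMeasurable_poissonFactor hF).lintegral_mul_swap hw]
  have h1 : ∀ᵐ η ∂P, ∫⁻ S, s.indicator 1 S * (F η).poissonFactor S ∂setMeasure (Aug I X) =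
      ∫⁻ S, s.indicator 1 S * q.poissonFactor S ∂setMeasure (Aug I X) := by
    filter_upwards [h] with η hη
    refine lintegral_congr_ae ?_
    filter_upwards [poissonFactor_congr_ae hη] with S hS
    rw [hS]
  rw [lintegral_congr_ae h1]
  simp

end PMB

end RFS

theorem lemma1 {d I : ℕ} (hd : 0 < d) {H : Type*} [MeasurableSpace H]
    (P : Measure H) [IsProbabilityMeasure P]
    (F : H → PMB I (EuclideanSpace ℝ (Fin d))) (hF : PMB.IsMeasurableFamily F) :
    -- the factors `E_η[f^U]`, `E_η[fⁱ]` are densities of labelled random finite sets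
    IsLabelledDensity 0 (PMB.meanPoissonFactor P F) ∧
    (∀ i, IsLabelledDensity i.succ (PMB.meanBernoulliFactor P F i)) ∧
    -- their product minimises the KLD among all densities `gU(S^U) ∏ᵢ gᵢ(Sⁱ)` ...
    (∀ gU g, IsLabelledDensity 0 gU → (∀ i : Fin I, IsLabelledDensity i.succ (g i)) →
      setKLD (PMB.meanDensity P F)
          (productDensity (PMB.meanPoissonFactor P F) (PMB.meanBernoulliFactor P F)) ≤
        setKLD (PMB.meanDensity P F) (productDensity gU g)) ∧
    -- ... and is the only minimiser, if the minimum is finite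
    (∀ gU g, IsLabelledDensity 0 gU → (∀ i : Fin I, IsLabelledDensity i.succ (g i)) →
      setKLD (PMB.meanDensity P F) (productDensity gU g) ≠ ∞ →
      (∀ gU' g', IsLabelledDensity 0 gU' →
        (∀ i : Fin I, IsLabelledDensity i.succ (g' i)) →
        setKLD (PMB.meanDensity P F) (productDensity gU g) ≤
          setKLD (PMB.meanDensity P F) (productDensity gU' g')) →
      gU =ᵐ[setMeasure _] PMB.meanPoissonFactor P F ∧
        ∀ i, g i =ᵐ[setMeasure _] PMB.meanBernoulliFactor P F i) ∧
    -- a PMB with the merged parameters exists, if the merged intensity is integrable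
    ((∫⁻ x, ∫⁻ η, (F η).intensity x ∂P) ≠ ∞ → ∃ q, PMB.IsMerged P F q) ∧
    -- it minimises the KLD among all PMB densities ...
    (∀ q, PMB.IsMerged P F q → ∀ q' : PMB I (EuclideanSpace ℝ (Fin d)),
      setKLD (PMB.meanDensity P F) q.density ≤
        setKLD (PMB.meanDensity P F) q'.density) ∧
    -- ... and every minimiser has the merged parameters, if the minimum is finite
    (∀ q : PMB I (EuclideanSpace ℝ (Fin d)),
      setKLD (PMB.meanDensity P F) q.density ≠ ∞ →
      (∀ q' : PMB I (EuclideanSpace ℝ (Fin d)),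
        setKLD (PMB.meanDensity P F) q.density ≤
          setKLD (PMB.meanDensity P F) q'.density) →
      PMB.IsMerged P F q) ∧
    -- its Bernoulli factors are `E_η[fⁱ]`; its Poisson factor is the Poisson density closest to
    -- `E_η[f^U]`, and is equal to it if the conditional intensity does not depend on `η`
    (∀ q, PMB.IsMerged P F q →
      (∀ i, q.bernoulliFactor i =ᵐ[setMeasure _] PMB.meanBernoulliFactor P F i) ∧
      (∀ q' : PMB I (EuclideanSpace ℝ (Fin d)),
        setKLD (PMB.meanPoissonFactor P F) q.poissonFactor ≤
          setKLD (PMB.meanPoissonFactor P F) q'.poissonFactor) ∧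
      ((∀ᵐ η ∂P, (F η).intensity =ᵐ[volume] q.intensity) →
        q.poissonFactor =ᵐ[setMeasure _] PMB.meanPoissonFactor P F)) := by
  have := Fin.pos_iff_nonempty.1 hd
  refine ⟨PMB.isLabelledDensity_meanPoissonFactor hF, PMB.isLabelledDensity_meanBernoulliFactor hF,
    fun gU g hgU hg => ?_, fun gU g hgU hg hfin hmin => ?_, PMB.exists_isMerged hF,
    fun q hq => PMB.setKLD_density_le_of_isMerged hF hq,
    fun q hfin hmin => PMB.isMerged_of_setKLD_density_le hF hfin hmin,
    fun q hq => ⟨PMB.bernoulliFactor_ae_eq_of_isMerged hF hq,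
      PMB.setKLD_poissonFactor_le_of_isMerged hF hq,
      PMB.poissonFactor_ae_eq_meanPoissonFactor hF⟩⟩
  · rw [PMB.setKLD_productDensity_eq_add hF hgU hg]
    exact le_self_add
  · exact PMB.ae_eq_of_setKLD_productDensity_le hF hgU hg hfin
      (hmin _ _ (PMB.isLabelledDensity_meanPoissonFactor hF)
        (PMB.isLabelledDensity_meanBernoulliFactor hF))
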